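/- For $k\ge 0$ and a graph $H$ let $k\cdot H$ be the disjoint union of $k$ copies of $H$; let $P_4$ be the path on four vertices and $S_3=K_{1,3}$ the star on four vertices. Let $F=a\cdot P_4\cup b\cdot S_3$ with integers $a\ge 1$, $b\ge 0$. An $n$-vertex graph is called extremal if it does not contain $F$ as a (not necessarily induced) subgraph and has the maximum number of edges among all such $n$-vertex graphs. A universal vertex is a vertex adjacent to all other vertices. Write $n-b=3d+r$ with integers $d\ge 0$ and $0\le r\le 2$. Let $G_F^1(n)$ be the $n$-vertex graph consisting of $b$ universal vertices together with $n-b$ further vertices that induce $K_r\cup d\cdot K_3$. Let $G_F^2(n)$ be the $n$-vertex graph consisting of $2a+b-1$ universal vertices together with $n-2a-b+1$ further vertices that form an independent set. For all $n$ sufficiently large (depending only on $a$ and $b$), the following hold, up to isomorphism. (i) If $a=1$ and $r=0$, then $G_F^1(n)$ is the unique extremal graph. If $a=1$, $r\ne 0$ and $b\ge 1$, then $G_F^1(n)$ and $G_F^2(n)$ are both extremal, and they are the only extremal graphs. (ii) If $a>1$, then $G_F^2(n)$ is the unique extremal graph. -/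

import Mathlib

namespace OrderFourForest

/-- The graph `k · H`: the disjoint union of `k` copies of the graph `H`. -/
def disjointCopies {V : Type*} (k : ℕ) (H : SimpleGraph V) : SimpleGraph (Fin k × V) where
  Adj x y := x.1 = y.1 ∧ H.Adj x.2 y.2
  symm := ⟨fun _ _ h => ⟨h.1.symm, h.2.symm⟩⟩
  loopless := ⟨fun _ h => H.irrefl h.2⟩

/-- The graph obtained from `H` by adding `k` new vertices, each of them adjacent to every
other (old or new) vertex. -/
def addUniversal {V : Type*} (k : ℕ) (H : SimpleGraph V) : SimpleGraph (Fin k ⊕ V) where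
  Adj
    | Sum.inr u, Sum.inr v => H.Adj u v
    | x, y => x ≠ y
  symm := ⟨by
    rintro (i | u) (j | v) h
    · exact Ne.symm h
    · exact Ne.symm h
    · exact Ne.symm h
    · exact H.adj_symm h⟩
  loopless := ⟨by
    rintro (i | u) h
    · exact h rfl
    · exact H.irrefl h⟩

/-- The path `P₄` on four vertices. -/
abbrev P4 : SimpleGraph (Fin 4) := SimpleGraph.pathGraph 4

/-- The star `S₃` on four vertices: a centre and three leaves. -/
abbrev S3 : SimpleGraph (Fin 4) := SimpleGraph.starGraph 0

/-- The forest `F = a · P₄ ∪ b · S₃` (disjoint union). -/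
def forest (a b : ℕ) : SimpleGraph (Fin a × Fin 4 ⊕ Fin b × Fin 4) :=
  SimpleGraph.sum (disjointCopies a P4) (disjointCopies b S3)

/-- The graph `G¹_F(n)` for `F = a · P₄ ∪ b · S₃`: it has `b` universal vertices, and the other
`n - b = 3 d + r` vertices (`r ≤ 2`) induce `K_r ∪ d · K₃`. It has `n` vertices if `b ≤ n`, and
does not depend on `a`. -/
def graphOne (b n : ℕ) :
    SimpleGraph (Fin b ⊕ (Fin ((n - b) % 3) ⊕ Fin ((n - b) / 3) × Fin 3)) :=
  addUniversal b (SimpleGraph.sum ⊤ (disjointCopies ((n - b) / 3) ⊤))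

/-- The graph `G²_F(n)` for `F = a · P₄ ∪ b · S₃`: it has `2a + b - 1` universal vertices, and the
other vertices are independent. It has `n` vertices if `1 ≤ a` and `2a + b - 1 ≤ n`. -/
def graphTwo (a b n : ℕ) : SimpleGraph (Fin (2 * a + b - 1) ⊕ Fin (n - (2 * a + b - 1))) :=
  addUniversal (2 * a + b - 1) ⊥

end OrderFourForest

/-! Both candidates are `F`-free by counting pieces. In `graphTwo` every edge meets a universal
vertex, so each path uses two of them and each star one. In `graphOne` each piece uses a universal
vertex, since the components outside have at most three vertices. For the converse, a large `F`-free
graph with at least as many edges as the candidate is peeled by deleting vertices of large degree.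
If `b ≥ 1`, bounded degrees would let copies of `P4` and `S3` be packed greedily, so some vertex `v`
has large degree; then `G - v` has no copy of the forest with one star fewer, as a star at `v` would
complete it. If there are only `a ≥ 2` paths, two vertices `u`, `v` have many common neighbours, and
a path `x u y v` plays the same role. A deleted vertex loses at most the degree of a universal
vertex, so the edge bound is inherited; once the smaller graph is known to be a join, the same count
shows that the deleted vertex is universal. The base cases rest on `card_edgeFinset_le_of_free`: a
`P4`-free graph has at most as many edges as vertices, with equality only for disjoint triangles.
For `r ≠ 0` one edge less is the maximum; the two outcomes come from
`nonempty_iso_cliquesGraph_or_exists` and `forall_edge_of_path_star_free`. For two paths,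
`nonempty_iso_of_two_paths_free` shows that the edges left after deleting `u` and `v` pairwise
intersect, hence form a star. -/

namespace OrderFourForest

open Finset SimpleGraph

section Copies

variable {V : Type*} {G : SimpleGraph V}

/-! ### Copies of paths, stars and forests -/

/-- A copy of `P₄` given by its four vertices. -/
def pathCopy {p q r s : V} (hpq : G.Adj p q) (hqr : G.Adj q r) (hrs : G.Adj r s)
    (hpr : p ≠ r) (hps : p ≠ s) (hqs : q ≠ s) : Copy P4 G where
  toHom := ⟨![p, q, r, s], by
    intro i j h
    rw [pathGraph_adj] at h
    fin_cases i <;> fin_cases j <;> simp at h ⊢ <;>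
      first | assumption | (apply G.adj_symm; assumption)⟩
  injective' := by
    have h1 := hpq.ne
    have h2 := hqr.ne
    have h3 := hrs.ne
    intro i j h
    fin_cases i <;> fin_cases j <;> simp_all [eq_comm]

/-- A copy of `S₃` given by its centre and its three leaves. -/
def starCopy {c x y z : V} (hx : G.Adj c x) (hy : G.Adj c y) (hz : G.Adj c z)
    (hxy : x ≠ y) (hxz : x ≠ z) (hyz : y ≠ z) : Copy S3 G where
  toHom := ⟨![c, x, y, z], by
    intro i j h
    rw [starGraph_adj] at h
    fin_cases i <;> fin_cases j <;> simp at h ⊢ <;>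
      first | assumption | (apply G.adj_symm; assumption)⟩
  injective' := by
    have h1 := hx.ne
    have h2 := hy.ne
    have h3 := hz.ne
    intro i j h
    fin_cases i <;> fin_cases j <;> simp_all [eq_comm]

theorem range_pathCopy {p q r s : V} (hpq : G.Adj p q) (hqr : G.Adj q r) (hrs : G.Adj r s)
    (hpr : p ≠ r) (hps : p ≠ s) (hqs : q ≠ s) :
    Set.range (pathCopy hpq hqr hrs hpr hps hqs) = {p, q, r, s} := by
  change Set.range ![p, q, r, s] = _
  ext v
  simp [eq_comm]
  tauto

theorem range_starCopy {c x y z : V} (hx : G.Adj c x) (hy : G.Adj c y) (hz : G.Adj c z)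
    (hxy : x ≠ y) (hxz : x ≠ z) (hyz : y ≠ z) :
    Set.range (starCopy hx hy hz hxy hxz hyz) = {c, x, y, z} := by
  change Set.range ![c, x, y, z] = _
  ext v
  simp [eq_comm]
  tauto

/-- The new path gets index `0` and the old ones are shifted. The bound on the range lets
`exists_copy_forest_one_zero` stay inside a prescribed path, so that disjointness from other pieces
survives. -/
theorem exists_copy_forest_succ_path {a b : ℕ} (f : Copy (forest a b) G) (g : Copy P4 G)
    (h : Disjoint (Set.range f) (Set.range g)) :
    ∃ f' : Copy (forest (a + 1) b) G, Set.range f' ⊆ Set.range f ∪ Set.range g := by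
  have h' : ∀ x i, f x ≠ g i := fun x i e =>
    Set.disjoint_left.1 h ⟨x, rfl⟩ ⟨i, e.symm⟩
  let F : Fin (a + 1) × Fin 4 ⊕ Fin b × Fin 4 → V :=
    Sum.elim (fun x => Fin.cases (motive := fun _ => V) (g x.2) (fun i => f (Sum.inl (i, x.2))) x.1)
      (fun x => f (Sum.inr x))
  refine ⟨⟨⟨F, ?_⟩, ?_⟩, ?_⟩
  · rintro (⟨i, x⟩ | ⟨i, x⟩) (⟨j, y⟩ | ⟨j, y⟩) hxy
    · obtain ⟨rfl, hxy⟩ : i = j ∧ P4.Adj x y := hxy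
      refine Fin.cases ?_ (fun i => ?_) i
      · exact g.toHom.map_adj hxy
      · exact f.toHom.map_adj (v := Sum.inl (i, x)) (w := Sum.inl (i, y))
          (show _ ∧ _ from ⟨rfl, hxy⟩)
    · simp [forest] at hxy
    · simp [forest] at hxy
    · exact f.toHom.map_adj (v := Sum.inr (i, x)) (w := Sum.inr (j, y)) hxy
  · have key : ∀ u v, F u = F v → u = v := by
      rintro (⟨i, x⟩ | ⟨i, x⟩) (⟨j, y⟩ | ⟨j, y⟩)
      · refine Fin.cases ?_ (fun i => ?_) i <;> refine Fin.cases ?_ (fun j => ?_) j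
        · intro e
          have := g.injective e
          simp_all
        · intro e; exact absurd e.symm (h' _ _)
        · intro e; exact absurd e (h' _ _)
        · intro e
          have := f.injective e
          simp_all
      · refine Fin.cases ?_ (fun i => ?_) i
        · intro e; exact absurd e.symm (h' _ _)
        · intro e
          have := f.injective e
          simp_all
      · refine Fin.cases ?_ (fun j => ?_) j
        · intro e; exact absurd e (h' _ _)
        · intro e
          have := f.injective e
          simp_all
      · intro e
        have := f.injective e
        simp_all
    exact fun u v e => key u v e
  · rintro _ ⟨⟨i, x⟩ | ⟨i, x⟩, rfl⟩
    · refine Fin.cases ?_ (fun i => ?_) i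
      · exact Or.inr ⟨x, rfl⟩
      · exact Or.inl ⟨Sum.inl (i, x), rfl⟩
    · exact Or.inl ⟨Sum.inr (i, x), rfl⟩

theorem exists_copy_forest_succ_star {a b : ℕ} (f : Copy (forest a b) G) (g : Copy S3 G)
    (h : Disjoint (Set.range f) (Set.range g)) :
    ∃ f' : Copy (forest a (b + 1)) G, Set.range f' ⊆ Set.range f ∪ Set.range g := by
  have h' : ∀ x i, f x ≠ g i := fun x i e =>
    Set.disjoint_left.1 h ⟨x, rfl⟩ ⟨i, e.symm⟩
  let F : Fin a × Fin 4 ⊕ Fin (b + 1) × Fin 4 → V :=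
    Sum.elim (fun x => f (Sum.inl x))
      (fun x => Fin.cases (motive := fun _ => V) (g x.2) (fun i => f (Sum.inr (i, x.2))) x.1)
  refine ⟨⟨⟨F, ?_⟩, ?_⟩, ?_⟩
  · rintro (⟨i, x⟩ | ⟨i, x⟩) (⟨j, y⟩ | ⟨j, y⟩) hxy
    · exact f.toHom.map_adj (v := Sum.inl (i, x)) (w := Sum.inl (j, y)) hxy
    · simp [forest] at hxy
    · simp [forest] at hxy
    · obtain ⟨rfl, hxy⟩ : i = j ∧ S3.Adj x y := hxy
      refine Fin.cases ?_ (fun i => ?_) i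
      · exact g.toHom.map_adj hxy
      · exact f.toHom.map_adj (v := Sum.inr (i, x)) (w := Sum.inr (i, y))
          (show _ ∧ _ from ⟨rfl, hxy⟩)
  · have key : ∀ u v, F u = F v → u = v := by
      rintro (⟨i, x⟩ | ⟨i, x⟩) (⟨j, y⟩ | ⟨j, y⟩)
      · intro e
        have := f.injective e
        simp_all
      · refine Fin.cases ?_ (fun j => ?_) j
        · intro e; exact absurd e (h' _ _)
        · intro e
          have := f.injective e
          simp_all
      · refine Fin.cases ?_ (fun i => ?_) i
        · intro e; exact absurd e.symm (h' _ _)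
        · intro e
          have := f.injective e
          simp_all
      · refine Fin.cases ?_ (fun i => ?_) i <;> refine Fin.cases ?_ (fun j => ?_) j
        · intro e
          have := g.injective e
          simp_all
        · intro e; exact absurd e.symm (h' _ _)
        · intro e; exact absurd e (h' _ _)
        · intro e
          have := f.injective e
          simp_all
    exact fun u v e => key u v e
  · rintro _ ⟨⟨i, x⟩ | ⟨i, x⟩, rfl⟩
    · exact Or.inl ⟨Sum.inl (i, x), rfl⟩
    · refine Fin.cases ?_ (fun i => ?_) i
      · exact Or.inr ⟨x, rfl⟩
      · exact Or.inl ⟨Sum.inr (i, x), rfl⟩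

/-- The copy of the empty forest. -/
def emptyCopy (G : SimpleGraph V) : Copy (forest 0 0) G where
  toHom := ⟨fun x => x.elim (fun y => y.1.elim0) (fun y => y.1.elim0), by
    rintro (⟨i, -⟩ | ⟨i, -⟩) <;> exact i.elim0⟩
  injective' := by rintro (⟨i, -⟩ | ⟨i, -⟩) <;> exact i.elim0

theorem exists_copy_forest_one_zero (g : Copy P4 G) :
    ∃ f : Copy (forest 1 0) G, Set.range f ⊆ Set.range g := by
  have h : Set.range (emptyCopy G) = ∅ := by
    rw [Set.range_eq_empty_iff]
    exact ⟨by rintro (⟨i, -⟩ | ⟨i, -⟩) <;> exact i.elim0⟩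
  obtain ⟨f, hf⟩ := exists_copy_forest_succ_path (emptyCopy G) g (by simp [h])
  exact ⟨f, by simpa [h] using hf⟩

theorem forest_one_zero_isContained_iff : forest 1 0 ⊑ G ↔ P4 ⊑ G := by
  refine ⟨fun ⟨f⟩ => ⟨f.comp ⟨⟨fun x => Sum.inl (0, x), ?_⟩, ?_⟩⟩, fun ⟨g⟩ => ?_⟩
  · intro x y h
    exact ⟨rfl, h⟩
  · intro x y h
    exact (Prod.mk.inj (Sum.inl.inj h)).2
  · obtain ⟨f, -⟩ := exists_copy_forest_one_zero g
    exact ⟨f⟩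

theorem card_range_copy_forest {a b : ℕ} [DecidableEq V] (f : Copy (forest a b) G) :
    #(univ.image f) = 4 * (a + b) := by
  rw [card_image_of_injective _ (show Function.Injective f from f.injective)]
  simp
  ring

end Copies

section PathFree

variable {V : Type*} {G : SimpleGraph V}

/-! ### Counting edges after deleting vertices -/

section Counting

theorem card_of_mem_iff_notMem [Fintype V] {S : Finset V} {T : Set V} [Fintype T]
    (hT : ∀ v, v ∈ T ↔ v ∉ S) : Fintype.card T = Fintype.card V - #S := by
  obtain rfl : T = (S : Set V)ᶜ := by ext v; simp [hT]
  rw [Fintype.card_compl_set]; simp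

theorem card_compl_singleton [Fintype V] (v : V) [Fintype ({v}ᶜ : Set V)] :
    Fintype.card ({v}ᶜ : Set V) = Fintype.card V - 1 :=
  card_of_mem_iff_notMem (S := {v}) (by simp)

variable [Fintype V] [DecidableRel G.Adj]

/-- An edge not inside `T` is incident to a vertex of `S`. The complement `T` is given by membership
only, so that `{v}ᶜ` and `(Set.range f)ᶜ` both fit. -/
theorem card_edgeFinset_le_induce_add_sum_degree {S : Finset V} {T : Set V}
    (hT : ∀ v, v ∈ T ↔ v ∉ S) [Fintype (G.induce T).edgeSet] :
    #G.edgeFinset ≤ #(G.induce T).edgeFinset + ∑ v ∈ S, G.degree v := by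
  classical
  have h : G.edgeFinset ⊆
      (G.induce T).edgeFinset.map (Function.Embedding.subtype (· ∈ T)).sym2Map ∪
      S.biUnion fun v => G.incidenceFinset v := by
    intro e he
    induction e with | _ x y => ?_
    rw [mem_edgeFinset, mem_edgeSet] at he
    rw [mem_union, mem_map, mem_biUnion]
    by_cases hx : x ∈ S
    · exact Or.inr ⟨x, hx, by rw [mem_incidenceFinset]; exact ⟨he, by simp⟩⟩
    by_cases hy : y ∈ S
    · exact Or.inr ⟨y, hy, by rw [mem_incidenceFinset]; exact ⟨he, by simp⟩⟩
    exact Or.inl ⟨s(⟨x, (hT x).2 hx⟩, ⟨y, (hT y).2 hy⟩),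
      by rw [mem_edgeFinset, mem_edgeSet]; exact he, rfl⟩
  refine (card_le_card h).trans ((card_union_le _ _).trans ?_)
  rw [card_map]
  refine Nat.add_le_add_left (card_biUnion_le.trans (sum_le_sum fun v _ => ?_)) _
  rw [card_incidenceFinset_eq_degree]

theorem card_edgeFinset_le_induce_add_degree (v : V)
    [Fintype (G.induce ({v}ᶜ : Set V)).edgeSet] :
    #G.edgeFinset ≤ #(G.induce ({v}ᶜ : Set V)).edgeFinset + G.degree v := by
  simpa using card_edgeFinset_le_induce_add_sum_degree (G := G) (S := {v}) (T := {v}ᶜ) (by simp)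

theorem degree_induce_of_closed {S : Finset V} {T : Set V} (hT : ∀ v, v ∈ T ↔ v ∉ S)
    (hS : ∀ x ∈ S, ∀ y, G.Adj x y → y ∈ S) (w : T) [Fintype ((G.induce T).neighborSet w)] :
    (G.induce T).degree w = G.degree w := by
  classical
  rw [← degree_induce_of_neighborSet_subset (s := T) (v := w) fun y hy => (hT y).2 fun hyS =>
    (hT w).1 w.2 (hS y hyS w (G.adj_symm hy))]
  congr!

/-- The number of edges of a graph in terms of a set of vertices that sends out no edges. -/
theorem two_mul_card_edgeFinset_of_closed {S : Finset V} {T : Set V} (hT : ∀ v, v ∈ T ↔ v ∉ S)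
    (hS : ∀ x ∈ S, ∀ y, G.Adj x y → y ∈ S) [Fintype (G.induce T).edgeSet] :
    2 * #G.edgeFinset = ∑ v ∈ S, G.degree v + 2 * #(G.induce T).edgeFinset := by
  classical
  have h1 := sum_degrees_eq_twice_card_edges G
  have h2 := sum_degrees_eq_twice_card_edges (G.induce T)
  rw [sum_congr rfl fun w _ => degree_induce_of_closed hT hS w] at h2
  rw [← sum_subtype (p := (· ∈ T)) Sᶜ (fun x => by simp [hT]) (fun w => G.degree w)] at h2
  rw [← h1, ← sum_add_sum_compl S, h2]
  congr!

end Counting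

/-! ### Graphs without a path on four vertices -/

theorem eq_of_path_of_free (hG : P4.Free G) {p q r s : V} (hpq : G.Adj p q) (hqr : G.Adj q r)
    (hrs : G.Adj r s) (hpr : p ≠ r) (hqs : q ≠ s) : p = s := by
  by_contra hps
  exact hG ⟨pathCopy hpq hqr hrs hpr hps hqs⟩

theorem free_induce {W : Type*} {A : SimpleGraph W} (hG : A.Free G) (T : Set V) :
    A.Free (G.induce T) :=
  fun h => hG (h.trans ⟨Copy.induce G T⟩)

theorem exists_adj_ne_of_two_le_degree {v : V} [Fintype (G.neighborSet v)] (h : 2 ≤ G.degree v)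
    (w : V) : ∃ x, G.Adj v x ∧ x ≠ w := by
  obtain ⟨x, hx, hxw⟩ := exists_mem_ne (s := G.neighborFinset v)
    (by rw [card_neighborFinset_eq_degree]; omega) w
  exact ⟨x, by simpa using hx, hxw⟩

theorem exists_adj_ne_ne_of_three_le_degree {v : V} [Fintype (G.neighborSet v)]
    (h : 3 ≤ G.degree v) (w w' : V) : ∃ x, G.Adj v x ∧ x ≠ w ∧ x ≠ w' := by
  classical
  obtain ⟨x, hx, hx'⟩ := exists_mem_notMem_of_card_lt_card (s := {w, w'})
    (t := G.neighborFinset v) (by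
      rw [card_neighborFinset_eq_degree]; exact lt_of_le_of_lt card_le_two h)
  simp at hx hx'
  exact ⟨x, hx, hx'⟩

/-- In a graph without `P₄` and with minimum degree two, every degree is two. -/
theorem degree_eq_two_of_free [Fintype V] [DecidableRel G.Adj] (hG : P4.Free G)
    (h : ∀ v, 2 ≤ G.degree v) (v : V) : G.degree v = 2 := by
  by_contra hv
  have hv : 3 ≤ G.degree v := by have := h v; omega
  -- A third neighbour `y` of `v` starts the forbidden path `y v x z`.
  obtain ⟨x, hx, -⟩ := exists_adj_ne_of_two_le_degree (h v) v
  obtain ⟨z, hz, hzv⟩ := exists_adj_ne_of_two_le_degree (h x) v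
  obtain ⟨y, hy, hyx, hyz⟩ := exists_adj_ne_ne_of_three_le_degree hv x z
  exact hyz (eq_of_path_of_free hG hy.symm hx hz hyx hzv.symm)

/-- A graph without `P₄` has at most as many edges as vertices, and if it has as many, then all
degrees are two. -/
theorem card_edgeFinset_le_of_free (n : ℕ) : ∀ (V : Type) [Fintype V] (G : SimpleGraph V)
    [DecidableRel G.Adj], Fintype.card V = n → P4.Free G →
    #G.edgeFinset ≤ n ∧ (#G.edgeFinset = n → ∀ v, G.degree v = 2) := by
  classical
  induction n with
  | zero =>
    intro V _ G _ hV hG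
    have := Fintype.card_eq_zero_iff.1 hV
    exact ⟨by simp [Subsingleton.elim G ⊥], fun _ v => isEmptyElim v⟩
  | succ n ih =>
    intro V _ G _ hV hG
    by_cases hd : ∀ v, 2 ≤ G.degree v
    · have h := degree_eq_two_of_free hG hd
      refine ⟨?_, fun _ => h⟩
      have := sum_degrees_eq_twice_card_edges G
      simp [h, hV] at this
      omega
    · push Not at hd
      obtain ⟨v, hv⟩ := hd
      obtain ⟨h1, h2⟩ := ih _ (G.induce ({v}ᶜ : Set V)) (by rw [card_compl_singleton, hV]; rfl)
        (free_induce hG _)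
      have h3 := card_edgeFinset_le_induce_add_degree (G := G) v
      refine ⟨by omega, fun h => ?_⟩
      exfalso
      -- Equality would force `v` to be a leaf attached to a 2-regular graph, and then `v x y w` is
      -- a `P4`.
      have h4 : 0 < G.degree v := by omega
      specialize h2 (by omega)
      obtain ⟨x, hx⟩ := (degree_pos_iff_exists_adj ..).1 h4
      obtain ⟨y, hy, -⟩ := exists_adj_ne_of_two_le_degree (h2 ⟨x, hx.ne'⟩).ge ⟨x, hx.ne'⟩
      obtain ⟨w, hw, hwx⟩ := exists_adj_ne_of_two_le_degree (h2 y).ge ⟨x, hx.ne'⟩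
      have hxw : x ≠ w := fun e => hwx (Subtype.ext e.symm)
      exact w.2 (eq_of_path_of_free hG hx hy hw (fun e => y.2 e.symm) hxw).symm

/-- A `2`-regular graph without `P₄` is a disjoint union of triangles. -/
theorem exists_iso_disjointCopies_of_free [Fintype V] [DecidableRel G.Adj] (hG : P4.Free G)
    (h : ∀ v, G.degree v = 2) :
    ∃ d, Fintype.card V = 3 * d ∧
      Nonempty (G ≃g disjointCopies d (⊤ : SimpleGraph (Fin 3))) := by
  classical
  -- The other neighbour `w` of `x` gives a walk `w x y z`, which must close up to `w = z`. So
  -- adjacency or equality is an equivalence relation, with classes of size three.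
  have htrans : ∀ {x y z}, G.Adj x y → G.Adj y z → x ≠ z → G.Adj x z := by
    intro x y z hxy hyz hxz
    obtain ⟨w, hw, hwy⟩ := exists_adj_ne_of_two_le_degree (h x).ge y
    rwa [← eq_of_path_of_free hG hw.symm hxy hyz hwy hxz]
  let S : Setoid V :=
    { r := fun x y => x = y ∨ G.Adj x y
      iseqv := ⟨fun x => Or.inl rfl, fun h => h.imp Eq.symm G.adj_symm, by
        rintro x y z (rfl | hxy) (rfl | hyz)
        · exact Or.inl rfl
        · exact Or.inr hyz
        · exact Or.inr hxy
        · by_cases hxz : x = z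
          · exact Or.inl hxz
          · exact Or.inr (htrans hxy hyz hxz)⟩ }
  have hr : ∀ x y, (Quotient.mk S x = Quotient.mk S y) ↔ x = y ∨ G.Adj x y :=
    fun x y => Quotient.eq
  have hcard : ∀ q : Quotient S, Fintype.card {x // Quotient.mk S x = q} = 3 := by
    intro q
    induction q using Quotient.inductionOn with | _ x => ?_
    rw [Fintype.card_subtype]
    have : (univ.filter fun y => Quotient.mk S y = Quotient.mk S x) =
        insert x (G.neighborFinset x) := by
      ext y
      simp [hr, G.adj_comm]
    rw [this, card_insert_of_notMem (by simp), card_neighborFinset_eq_degree, h]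
  let e : V ≃ Fin (Fintype.card (Quotient S)) × Fin 3 :=
    (Equiv.sigmaFiberEquiv (Quotient.mk S)).symm.trans <|
      (Equiv.sigmaCongrRight fun q => Fintype.equivFinOfCardEq (hcard q)).trans <|
      (Equiv.sigmaEquivProd _ _).trans <| (Fintype.equivFin _).prodCongr (Equiv.refl _)
  have he : ∀ x, (e x).1 = Fintype.equivFin _ (Quotient.mk S x) := fun x => rfl
  refine ⟨Fintype.card (Quotient S), ?_, ⟨⟨e, ?_⟩⟩⟩
  · rw [Fintype.card_congr e]; simp; ring
  · intro x y
    change (e x).1 = (e y).1 ∧ (e x).2 ≠ (e y).2 ↔ _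
    rw [he, he, (Fintype.equivFin _).injective.eq_iff, hr]
    constructor
    · rintro ⟨rfl | h, h'⟩
      · exact absurd rfl h'
      · exact h
    · intro hxy
      refine ⟨Or.inr hxy, fun h' => hxy.ne (e.injective (Prod.ext ?_ h'))⟩
      rw [he, he, (hr x y).2 (Or.inr hxy)]

end PathFree

section Joins

variable {V W : Type*} {G : SimpleGraph V}

/-! ### Isomorphisms with disjoint unions and with joins -/

theorem nonempty_iso_sum {W₁ W₂ : Type*} {A : SimpleGraph W₁} {B : SimpleGraph W₂} {S : Set V}
    (hS : ∀ x ∈ S, ∀ y, G.Adj x y → y ∈ S) (φ : G.induce S ≃g A) (ψ : G.induce Sᶜ ≃g B) :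
    Nonempty (G ≃g A.sum B) := by
  classical
  let e : V ≃ W₁ ⊕ W₂ := (Equiv.Set.sumCompl S).symm.trans (φ.toEquiv.sumCongr ψ.toEquiv)
  have h1 : ∀ (x : V) (hx : x ∈ S), e x = Sum.inl (φ ⟨x, hx⟩) := fun x hx => by
    simp [e, Equiv.Set.sumCompl_symm_apply_of_mem hx]
  have h2 : ∀ (x : V) (hx : x ∉ S), e x = Sum.inr (ψ ⟨x, hx⟩) := fun x hx => by
    simp [e, Equiv.Set.sumCompl_symm_apply_of_notMem hx]
  refine ⟨⟨e, fun {x y} => ?_⟩⟩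
  by_cases hx : x ∈ S <;> by_cases hy : y ∈ S
  · rw [h1 x hx, h1 y hy, sum_adj_inl, φ.map_adj_iff]; rfl
  · rw [h1 x hx, h2 y hy]
    simpa using fun h => hy (hS x hx y h)
  · rw [h2 x hx, h1 y hy]
    simpa using fun h => hx (hS y hy x (G.adj_symm h))
  · rw [h2 x hx, h2 y hy, sum_adj_inr, ψ.map_adj_iff]; rfl

/-- A universal vertex can be moved into the universal part of a join. -/
theorem nonempty_iso_addUniversal_succ {k : ℕ} {H : SimpleGraph W} {v : V}
    (hv : ∀ x, x ≠ v → G.Adj v x) (φ : G.induce ({v}ᶜ : Set V) ≃g addUniversal k H) :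
    Nonempty (G ≃g addUniversal (k + 1) H) := by
  let F : Fin (k + 1) ⊕ W → V := Sum.elim
    (Fin.cases (motive := fun _ => V) v fun i => φ.symm (Sum.inl i)) fun w => φ.symm (Sum.inr w)
  have hne : ∀ x, (φ.symm x : V) ≠ v := fun x => (φ.symm x).2
  have hinj : ∀ {x y}, (φ.symm x : V) = φ.symm y → x = y := fun h =>
    φ.symm.injective (Subtype.ext h)
  have hadj : ∀ x y, G.Adj (φ.symm x) (φ.symm y) ↔ (addUniversal k H).Adj x y := fun x y =>
    φ.symm.map_adj_iff
  have hbij : Function.Bijective F := by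
    constructor
    · rintro (i | w) (j | w')
      · refine Fin.cases ?_ (fun i => ?_) i <;> refine Fin.cases ?_ (fun j => ?_) j
        · exact fun _ => rfl
        · exact fun h => absurd h.symm (hne _)
        · exact fun h => absurd h (hne _)
        · exact fun h => congrArg (fun i => Sum.inl (Fin.succ i)) (Sum.inl.inj (hinj h))
      · refine Fin.cases ?_ (fun i => ?_) i
        · exact fun h => absurd h.symm (hne _)
        · exact fun h => by simpa using hinj h
      · refine Fin.cases ?_ (fun j => ?_) j
        · exact fun h => absurd h (hne _)
        · exact fun h => by simpa using hinj h
      · exact fun h => by rw [Sum.inr.inj (hinj h)]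
    · intro x
      by_cases hx : x = v
      · exact ⟨Sum.inl 0, hx.symm⟩
      · have h := congrArg Subtype.val (φ.symm_apply_apply ⟨x, hx⟩)
        rcases h' : φ ⟨x, hx⟩ with i | w
        · rw [h'] at h
          exact ⟨Sum.inl i.succ, h⟩
        · rw [h'] at h
          exact ⟨Sum.inr w, h⟩
  refine ⟨Iso.symm ⟨Equiv.ofBijective F hbij, fun {x y} => ?_⟩⟩
  rw [Equiv.ofBijective_apply, Equiv.ofBijective_apply]
  rcases x with i | w <;> rcases y with j | w'
  · change _ ↔ Sum.inl i ≠ Sum.inl j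
    refine Fin.cases ?_ (fun i => ?_) i <;> refine Fin.cases ?_ (fun j => ?_) j
    · simp
    · exact iff_of_true (hv _ (hne _)) (by simp [Fin.ext_iff])
    · exact iff_of_true (hv _ (hne _)).symm (by simp [Fin.ext_iff])
    · refine (hadj _ _).trans ?_
      change Sum.inl i ≠ Sum.inl j ↔ _
      simp
  · refine iff_of_true ?_ (show Sum.inl i ≠ Sum.inr w' by simp)
    refine Fin.cases ?_ (fun i => ?_) i
    · exact hv _ (hne _)
    · exact (hadj _ _).2 (show Sum.inl i ≠ Sum.inr w' by simp)
  · refine iff_of_true ?_ (show Sum.inr w ≠ Sum.inl j by simp)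
    refine Fin.cases ?_ (fun j => ?_) j
    · exact (hv _ (hne _)).symm
    · exact (hadj _ _).2 (show Sum.inr w ≠ Sum.inl j by simp)
  · exact hadj _ _

theorem nonempty_iso_addUniversal_zero (H : SimpleGraph W) :
    Nonempty (H ≃g addUniversal 0 H) :=
  ⟨⟨(Equiv.emptySum (Fin 0) W).symm, Iff.rfl⟩⟩

/-! ### Edge counts -/

section EdgeCounts

variable [Fintype V] [Fintype W] [DecidableRel G.Adj]

/-- As a double sum, the count splits into blocks over sum types, which yields the edge counts
below. -/
theorem two_mul_card_edgeFinset_eq_sum [Fintype G.edgeSet] :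
    2 * #G.edgeFinset = ∑ x, ∑ y, if G.Adj x y then 1 else 0 := by
  have h := two_mul_card_edgeFinset (G := G)
  rw [card_filter, Fintype.sum_prod_type] at h
  convert! h

theorem card_edgeFinset_addUniversal (k : ℕ) (H : SimpleGraph W) [DecidableRel H.Adj]
    [Fintype (addUniversal k H).edgeSet] :
    #(addUniversal k H).edgeFinset =
      k.choose 2 + k * Fintype.card W + #H.edgeFinset := by
  classical
  have h : 2 * #(addUniversal k H).edgeFinset =
      k * (k - 1) + 2 * (k * Fintype.card W) + 2 * #H.edgeFinset := by
    have h0 := two_mul_card_edgeFinset_eq_sum (G := addUniversal k H)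
    have e1 : ∀ i j : Fin k, (addUniversal k H).Adj (Sum.inl i) (Sum.inl j) ↔ i ≠ j :=
      fun i j => Sum.inl_injective.ne_iff
    have e2 : ∀ (i : Fin k) (w : W), (addUniversal k H).Adj (Sum.inl i) (Sum.inr w) :=
      fun i w => Sum.inl_ne_inr
    have e3 : ∀ (i : Fin k) (w : W), (addUniversal k H).Adj (Sum.inr w) (Sum.inl i) :=
      fun i w => Sum.inr_ne_inl
    have e4 : ∀ w w' : W, (addUniversal k H).Adj (Sum.inr w) (Sum.inr w') ↔ H.Adj w w' :=
      fun _ _ => Iff.rfl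
    have e5 : ∀ i : Fin k, (∑ j : Fin k, if i ≠ j then 1 else 0) = k - 1 := by
      intro i
      rw [← card_filter, filter_ne, card_erase_of_mem (mem_univ _)]
      simp
    simp only [Fintype.sum_sum_type, e1, e2, e3, e4, sum_add_distrib, e5] at h0
    rw [← two_mul_card_edgeFinset_eq_sum] at h0
    simp at h0
    have : Fintype.card W * k = k * Fintype.card W := mul_comm _ _
    omega
  have h2 : 2 * k.choose 2 = k * (k - 1) := by
    rw [Nat.choose_two_right, Nat.mul_div_cancel' (Nat.even_mul_pred_self k).two_dvd]
  omega

theorem card_edgeFinset_sum (H : SimpleGraph W) [DecidableRel H.Adj]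
    [Fintype (G.sum H).edgeSet] :
    #(G.sum H).edgeFinset = #G.edgeFinset + #H.edgeFinset := by
  classical
  have h0 := two_mul_card_edgeFinset_eq_sum (G := G.sum H)
  have e1 : ∀ v w, ¬ (G.sum H).Adj (Sum.inl v) (Sum.inr w) := by simp
  have e2 : ∀ v w, ¬ (G.sum H).Adj (Sum.inr w) (Sum.inl v) := by simp
  simp only [Fintype.sum_sum_type, sum_add_distrib, sum_adj_inl, sum_adj_inr, e1, e2] at h0
  rw [← two_mul_card_edgeFinset_eq_sum, ← two_mul_card_edgeFinset_eq_sum] at h0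
  simp only [if_false, sum_const_zero] at h0
  omega

theorem card_edgeFinset_disjointCopies_top (d : ℕ)
    [Fintype (disjointCopies d (⊤ : SimpleGraph (Fin 3))).edgeSet] :
    #(disjointCopies d (⊤ : SimpleGraph (Fin 3))).edgeFinset = 3 * d := by
  classical
  have h0 := two_mul_card_edgeFinset_eq_sum (G := disjointCopies d (⊤ : SimpleGraph (Fin 3)))
  have h : ∀ x, (∑ y, if (disjointCopies d (⊤ : SimpleGraph (Fin 3))).Adj x y then 1 else 0) =
      2 := by
    rintro ⟨i, j⟩
    rw [← card_filter]
    have : (univ.filter fun y => (disjointCopies d (⊤ : SimpleGraph (Fin 3))).Adj (i, j) y) =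
        {i} ×ˢ univ.erase j := by
      ext ⟨i', j'⟩
      simp only [mem_filter, mem_univ, true_and, mem_product, mem_singleton, mem_erase, and_true]
      exact and_congr eq_comm ne_comm
    rw [this, card_product]
    simp
  simp only [h] at h0
  simp at h0
  omega

end EdgeCounts

/-- The graph `K_r ∪ d · K₃`. -/
abbrev cliquesGraph (r d : ℕ) : SimpleGraph (Fin r ⊕ Fin d × Fin 3) :=
  SimpleGraph.sum ⊤ (disjointCopies d ⊤)

theorem card_edgeFinset_cliquesGraph (r d : ℕ) [Fintype (cliquesGraph r d).edgeSet] :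
    #(cliquesGraph r d).edgeFinset = r.choose 2 + 3 * d := by
  classical
  rw [card_edgeFinset_sum, card_edgeFinset_disjointCopies_top,
    card_edgeFinset_top_eq_card_choose_two, Fintype.card_fin]

/-! ### Freeness of the candidate graphs -/

/-- Disjoint pieces that each use a universal vertex use distinct ones. -/
theorem card_le_of_forall_exists_inl {k : ℕ} {α ι : Type*} [Fintype ι] {f : α → Fin k ⊕ W}
    (hf : Function.Injective f) (piece : α → ι)
    (h : ∀ i, ∃ x, piece x = i ∧ ∃ j, f x = Sum.inl j) : Fintype.card ι ≤ k := by
  choose x hx j hj using h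
  have : Function.Injective j := fun i i' e => by
    rw [← hx i, ← hx i', hf ((hj i).trans (e ▸ (hj i').symm))]
  simpa using Fintype.card_le_of_injective j this

theorem forest_free_addUniversal_bot {a b k : ℕ} (hk : k < 2 * a + b) :
    (forest a b).Free (addUniversal k (⊥ : SimpleGraph W)) := by
  rintro ⟨f⟩
  have hedge : ∀ x y, (forest a b).Adj x y → (∃ j, f x = Sum.inl j) ∨ ∃ j, f y = Sum.inl j := by
    intro x y hxy
    have := f.toHom.map_adj hxy
    simp only [Copy.toHom_apply] at this
    rcases hx : f x with j | w
    · exact Or.inl ⟨j, rfl⟩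
    rcases hy : f y with j | w'
    · exact Or.inr ⟨j, rfl⟩
    rw [hx, hy] at this
    exact this.elim
  -- Each path is cut into its two disjoint end edges, indexed by `Bool`, so there are `2 * a + b`
  -- pieces containing an edge.
  have := card_le_of_forall_exists_inl (ι := Fin a × Bool ⊕ Fin b) f.injective
    (Sum.elim (fun x => Sum.inl (x.1, decide (x.2 < 2))) fun x => Sum.inr x.1) (by
      rintro (⟨i, _ | _⟩ | i)
      · rcases hedge (Sum.inl (i, 2)) (Sum.inl (i, 3))
          (show _ ∧ _ from ⟨rfl, by simp [pathGraph_adj]⟩) with h | h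
        · exact ⟨_, by simp, h⟩
        · exact ⟨_, by simp, h⟩
      · rcases hedge (Sum.inl (i, 0)) (Sum.inl (i, 1))
          (show _ ∧ _ from ⟨rfl, by simp [pathGraph_adj]⟩) with h | h
        · exact ⟨_, by simp, h⟩
        · exact ⟨_, by simp, h⟩
      · rcases hedge (Sum.inr (i, 0)) (Sum.inr (i, 1))
          (show _ ∧ _ from ⟨rfl, by simp [starGraph_adj]⟩) with h | h
        · exact ⟨_, rfl, h⟩
        · exact ⟨_, rfl, h⟩)
  simp at this
  omega

/-- Four vertices of `K_r ∪ d · K₃`, `r ≤ 3`, do not all lie in the same component. -/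
theorem not_injective_of_component {r d : ℕ} (hr : r ≤ 3) {f : Fin 4 → Fin r ⊕ Fin d × Fin 3}
    (hf : Function.Injective f)
    (h : ∀ i, Sum.elim (fun _ => none) (fun x => some x.1) (f i) =
      Sum.elim (fun _ => none) (fun x => some x.1) (f 0)) : False := by
  -- Within one component `pos` determines the vertex, and it has only three values.
  let pos : Fin r ⊕ Fin d × Fin 3 → Fin 3 := Sum.elim (Fin.castLE hr) fun x => x.2
  have hinj : Function.Injective (pos ∘ f) := by
    intro i j e
    have hij := (h i).trans (h j).symm
    apply hf
    revert hij
    change pos (f i) = pos (f j) at e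
    rcases h1 : f i with x | ⟨x, y⟩ <;> rcases h2 : f j with x' | ⟨x', y'⟩ <;>
      simp_all [pos]
  simpa using Fintype.card_le_of_injective _ hinj

theorem component_eq_of_adj {r d : ℕ} {x y : Fin r ⊕ Fin d × Fin 3}
    (h : (cliquesGraph r d).Adj x y) :
    (Sum.elim (fun _ => none) (fun x => some x.1) x : Option (Fin d)) =
      Sum.elim (fun _ => none) (fun x => some x.1) y := by
  rcases x with x | x <;> rcases y with y | y <;> simp at h ⊢
  exact h.1

theorem forest_free_addUniversal_cliquesGraph {a b k r d : ℕ} (hr : r ≤ 3) (hk : k < a + b) :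
    (forest a b).Free (addUniversal k (cliquesGraph r d)) := by
  rintro ⟨f⟩
  -- The condition on `κ` is connectedness of `A`: a labelling constant along edges is constant.
  have key : ∀ (A : SimpleGraph (Fin 4)) (g : Copy A (forest a b)),
      (∀ κ : Fin 4 → Option (Fin d), (∀ i j, A.Adj i j → κ i = κ j) → ∀ i, κ i = κ 0) →
      ∃ i j, f (g i) = Sum.inl j := by
    intro A g hA
    by_contra! hno
    have : ∀ i, ∃ w, f (g i) = Sum.inr w := by
      intro i
      rcases h : f (g i) with j | w
      · exact absurd h (hno i j)
      · exact ⟨w, rfl⟩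
    choose w hw using this
    refine not_injective_of_component hr (f := w) (fun i j e => ?_)
      (hA _ fun i j hij => component_eq_of_adj ?_)
    · exact g.injective (f.injective ((hw i).trans (e ▸ (hw j).symm)))
    · have := f.toHom.map_adj (g.toHom.map_adj hij)
      simp only [Copy.toHom_apply] at this
      rw [hw, hw] at this
      exact this
  have := card_le_of_forall_exists_inl (ι := Fin a ⊕ Fin b) f.injective
    (Sum.map Prod.fst Prod.fst) (by
      rintro (i | i)
      · obtain ⟨x, hx⟩ := key P4 ⟨⟨fun x => Sum.inl (i, x), fun h => ⟨rfl, h⟩⟩, fun x y h =>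
          (Prod.mk.inj (Sum.inl.inj h)).2⟩ (by
            intro κ hκ
            have h1 := hκ 0 1 (by simp [pathGraph_adj])
            have h2 := hκ 1 2 (by simp [pathGraph_adj])
            have h3 := hκ 2 3 (by simp [pathGraph_adj])
            intro i
            fin_cases i <;> simp_all)
        exact ⟨_, rfl, hx⟩
      · obtain ⟨x, hx⟩ := key S3 ⟨⟨fun x => Sum.inr (i, x), fun h => ⟨rfl, h⟩⟩, fun x y h =>
          (Prod.mk.inj (Sum.inr.inj h)).2⟩ (by
            intro κ hκ i
            by_cases hi : i = 0
            · rw [hi]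
            · exact hκ i 0 (by simp [starGraph_adj, hi]))
        exact ⟨_, rfl, hx⟩)
  simp at this
  omega

end Joins

section LargeDegree

variable {V W : Type*} {G : SimpleGraph V}

/-! ### Vertices of large degree -/

section Degrees

variable [Fintype V] [DecidableRel G.Adj]

theorem adj_of_card_le_degree_add_one {v x : V} (h : Fintype.card V ≤ G.degree v + 1)
    (hx : x ≠ v) : G.Adj v x := by
  classical
  by_contra hn
  have : G.neighborFinset v ⊆ (univ.erase v).erase x := by
    intro y hy
    rw [mem_neighborFinset] at hy
    simp only [mem_erase, mem_univ, and_true]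
    exact ⟨fun e => hn (e ▸ hy), hy.ne'⟩
  have := card_le_card this
  rw [card_erase_of_mem (by simp [hx]), card_erase_of_mem (mem_univ _), card_univ,
    card_neighborFinset_eq_degree] at this
  have h2 : 1 < Fintype.card V := Fintype.one_lt_card_iff.2 ⟨x, v, hx⟩
  omega

theorem adj_or_adj_of_card_le_degree_add_two {v y z : V} (h : Fintype.card V ≤ G.degree v + 2)
    (hy : y ≠ v) (hz : z ≠ v) (hyz : y ≠ z) : G.Adj v y ∨ G.Adj v z := by
  classical
  by_contra! hn
  have : G.neighborFinset v ⊆ ((univ.erase v).erase y).erase z := by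
    intro x hx
    rw [mem_neighborFinset] at hx
    simp only [mem_erase, mem_univ, and_true]
    exact ⟨fun e => hn.2 (e ▸ hx), fun e => hn.1 (e ▸ hx), hx.ne'⟩
  have := card_le_card this
  rw [card_erase_of_mem (by simp [hz, hyz.symm]), card_erase_of_mem (by simp [hy]),
    card_erase_of_mem (mem_univ _), card_univ, card_neighborFinset_eq_degree] at this
  have h2 : 2 < Fintype.card V :=
    Fintype.two_lt_card_iff.2 ⟨v, y, z, hy.symm, hz.symm, hyz⟩
  omega

theorem exists_adj_notMem_of_card_lt_degree {v : V} {X : Finset V} (h : #X < G.degree v) :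
    ∃ x, G.Adj v x ∧ x ∉ X := by
  obtain ⟨x, hx, hxX⟩ := exists_mem_notMem_of_card_lt_card (s := X) (t := G.neighborFinset v)
    (by rwa [card_neighborFinset_eq_degree])
  exact ⟨x, by simpa using hx, hxX⟩

theorem exists_starCopy_disjoint_of_degree [DecidableEq V] {v : V} {X : Finset V} (hv : v ∉ X)
    (h : #X + 3 ≤ G.degree v) : ∃ g : Copy S3 G, ∀ x ∈ Set.range g, x ∉ X := by
  have h1 : 2 < #(G.neighborFinset v \ X) := by
    have := le_card_sdiff X (G.neighborFinset v)
    rw [card_neighborFinset_eq_degree] at this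
    omega
  obtain ⟨x, y, z, hx, hy, hz, hxy, hxz, hyz⟩ := two_lt_card_iff.1 h1
  simp only [mem_sdiff, mem_neighborFinset] at hx hy hz
  refine ⟨starCopy hx.1 hy.1 hz.1 hxy hxz hyz, ?_⟩
  rw [range_starCopy]
  rintro _ (rfl | rfl | rfl | rfl)
  exacts [hv, hx.2, hy.2, hz.2]

/-- An edge `yz` is extended to a `P₄` by a vertex of large degree that is adjacent to all vertices
but at most one. -/
theorem exists_pathCopy_disjoint_of_degree [DecidableEq V] {v y z : V} {X : Finset V}
    (hyz : G.Adj y z) (hy : y ≠ v) (hz : z ≠ v) (hv : Fintype.card V ≤ G.degree v + 2)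
    (hvX : v ∉ X) (hyX : y ∉ X) (hzX : z ∉ X) (h : #X + 3 ≤ G.degree v) :
    ∃ g : Copy P4 G, ∀ x ∈ Set.range g, x ∉ X := by
  -- As `v` misses at most one vertex, it is adjacent to `y` or `z`; a fresh neighbour `x` then
  -- gives the path `x v y z`.
  wlog hvy : G.Adj v y generalizing y z
  · exact this hyz.symm hz hy hzX hyX
      ((adj_or_adj_of_card_le_degree_add_two hv hy hz hyz.ne).resolve_left hvy)
  have h1 : #(insert y (insert z X)) < G.degree v := by
    have h2 := card_insert_le y (insert z X)
    have h3 := card_insert_le z X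
    omega
  obtain ⟨x, hx, hxX⟩ := exists_adj_notMem_of_card_lt_degree h1
  simp only [mem_insert, not_or] at hxX
  refine ⟨pathCopy hx.symm hvy hyz hxX.1 hxX.2.1 hz.symm, ?_⟩
  rw [range_pathCopy]
  rintro _ (rfl | rfl | rfl | rfl)
  exacts [hxX.2.2, hvX, hyX, hzX]

end Degrees

/-! ### Stars, and `P₄`-free graphs one edge below the maximum -/

/-- A graph with all edges at one vertex and at least `|V| - 1` edges is a star. -/
theorem nonempty_iso_star_of_forall_edge [Fintype V] [DecidableRel G.Adj] {m : ℕ} {c : V}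
    (hc : ∀ x y, G.Adj x y → x = c ∨ y = c) (hV : Fintype.card V = m + 1)
    (he : m ≤ #G.edgeFinset) : Nonempty (G ≃g addUniversal 1 (⊥ : SimpleGraph (Fin m))) := by
  classical
  have hbot : G.induce ({c}ᶜ : Set V) = ⊥ := by
    ext x y
    simp only [comap_adj, bot_adj, iff_false]
    intro h
    exact (hc _ _ h).elim x.2 y.2
  have h1 := card_edgeFinset_le_induce_add_degree (G := G) c
  have h2 : #(G.induce ({c}ᶜ : Set V)).edgeFinset = 0 := by
    rw [card_eq_zero, edgeFinset_eq_empty, hbot]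
  refine nonempty_iso_addUniversal_succ (v := c)
    (fun x hx => adj_of_card_le_degree_add_one (by omega) hx) ?_
  rw [hbot]
  have h3 : Fintype.card ({c}ᶜ : Set V) = Fintype.card (Fin m) := by
    rw [card_compl_singleton, hV, Fintype.card_fin]; rfl
  let ψ : (⊥ : SimpleGraph ({c}ᶜ : Set V)) ≃g (⊥ : SimpleGraph (Fin m)) :=
    ⟨Fintype.equivOfCardEq h3, Iff.rfl⟩
  exact ψ.trans (nonempty_iso_addUniversal_zero _).some

/-- The structure of `P₄`-free graphs with one edge less than vertices. -/
theorem nonempty_iso_cliquesGraph_or_exists {V : Type} [Fintype V] {G : SimpleGraph V}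
    [DecidableRel G.Adj] {d r : ℕ} (hr0 : r ≠ 0) (hr : r ≤ 2) (hV : Fintype.card V = 3 * d + r)
    (hG : P4.Free G) (he : #G.edgeFinset + 1 = Fintype.card V) :
    Nonempty (G ≃g cliquesGraph r d) ∨
      ∃ c, 3 ≤ G.degree c ∧ ∀ x, G.Adj c x → ∀ y, G.Adj x y → y = c := by
  classical
  -- The component of `c` is a star. Too few edges force a vertex `p` of degree at most one: `c` is
  -- `p` itself if isolated, and otherwise its neighbour.
  obtain ⟨c, hc⟩ : ∃ c, ∀ x, G.Adj c x → ∀ y, G.Adj x y → y = c := by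
    obtain ⟨p, hp⟩ : ∃ p, G.degree p < 2 := by
      by_contra! h
      have h1 := sum_degrees_eq_twice_card_edges G
      have h2 := sum_le_sum fun v (_ : v ∈ univ) => h v
      simp at h2
      omega
    rcases Nat.lt_succ_iff_lt_or_eq.1 hp with hp | hp
    · refine ⟨p, fun x hx => ?_⟩
      have := (degree_pos_iff_exists_adj G p).2 ⟨x, hx⟩
      omega
    · obtain ⟨q, hq, huniq⟩ := (degree_eq_one_iff_existsUnique_adj).1 hp
      refine ⟨q, fun x hx y hy => ?_⟩
      by_contra hyq
      by_cases hpx : p = x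
      · exact hyq (huniq y (hpx ▸ hy))
      · have := eq_of_path_of_free hG hq hx hy hpx (Ne.symm hyq)
        exact hx.ne (huniq x (this ▸ hy.symm)).symm
  by_cases h3 : 3 ≤ G.degree c
  · exact Or.inr ⟨c, h3, hc⟩
  left
  let S : Finset V := insert c (G.neighborFinset c)
  have hmem : ∀ x, x ∈ S ↔ x = c ∨ G.Adj c x := fun x => by simp [S]
  have hS : ∀ x ∈ S, ∀ y, G.Adj x y → y ∈ S := by
    intro x hx y hxy
    rw [hmem] at hx ⊢
    rcases hx with rfl | hx
    · exact Or.inr hxy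
    · exact Or.inl (hc x hx y hxy)
  have hT : ∀ v, v ∈ ((S : Set V)ᶜ) ↔ v ∉ S := by simp
  have hcard : #S = G.degree c + 1 := by
    rw [card_insert_of_notMem (by simp), card_neighborFinset_eq_degree]
  have hsum : ∑ v ∈ S, G.degree v = 2 * G.degree c := by
    rw [sum_insert (by simp), sum_congr rfl (g := fun _ => 1), sum_const,
      card_neighborFinset_eq_degree]
    · simp; ring
    · intro x hx
      rw [mem_neighborFinset] at hx
      rw [degree_eq_one_iff_existsUnique_adj]
      exact ⟨c, hx.symm, fun y hy => hc x hx y hy⟩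
  have h4 := two_mul_card_edgeFinset_of_closed hT hS
  have h5 := card_of_mem_iff_notMem hT
  have h6 : #S ≤ Fintype.card V := card_le_univ S
  -- The star `S` has one edge less than vertices, so the rest has as many edges as vertices and
  -- consists of triangles. Since `#S ≤ 3` and `r` is 1 or 2, counting modulo 3 gives `#S = r`.
  have hreg := (card_edgeFinset_le_of_free _ _ (G.induce (S : Set V)ᶜ) rfl
    (free_induce hG _)).2 (by omega)
  obtain ⟨d', hd', ⟨ψ⟩⟩ := exists_iso_disjointCopies_of_free (free_induce hG _) hreg
  obtain rfl : d = d' := by omega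
  have hSr : #S = r := by omega
  have htop : G.induce (S : Set V) = ⊤ := by
    ext x y
    simp only [comap_adj, top_adj, Function.Embedding.subtype_apply]
    refine ⟨fun h e => h.ne (congrArg _ e), fun hxy => ?_⟩
    have hxy : (x : V) ≠ y := fun e => hxy (Subtype.ext e)
    rcases (hmem x).1 x.2 with hx | hx <;> rcases (hmem y).1 y.2 with hy | hy
    · exact absurd (hx.trans hy.symm) hxy
    · rwa [hx]
    · rw [hy]; exact hx.symm
    · have : 1 < #(G.neighborFinset c) :=
        one_lt_card.2 ⟨x, by simpa using hx, y, by simpa using hy, hxy⟩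
      rw [card_neighborFinset_eq_degree] at this
      omega
  refine nonempty_iso_sum (S := (S : Set V)) hS ?_ ψ
  rw [htop]
  exact Iso.completeGraph (Fintype.equivOfCardEq (by simp [hSr]))

/-! ### Splitting off a component of the forest -/

theorem forest_succ_path_isContained_of_induce {a b : ℕ} (f : Copy (forest a b) G)
    (h : P4 ⊑ G.induce (Set.range f)ᶜ) : forest (a + 1) b ⊑ G := by
  obtain ⟨g⟩ := h
  obtain ⟨f', -⟩ := exists_copy_forest_succ_path f ((Copy.induce G _).comp g) (by
    rw [Set.disjoint_right]
    rintro _ ⟨i, rfl⟩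
    exact (g i).2)
  exact ⟨f'⟩

theorem forest_succ_star_isContained_of_induce {a b : ℕ} (f : Copy (forest a b) G)
    (h : S3 ⊑ G.induce (Set.range f)ᶜ) : forest a (b + 1) ⊑ G := by
  obtain ⟨g⟩ := h
  obtain ⟨f', -⟩ := exists_copy_forest_succ_star f ((Copy.induce G _).comp g) (by
    rw [Set.disjoint_right]
    rintro _ ⟨i, rfl⟩
    exact (g i).2)
  exact ⟨f'⟩

/-! ### Greedy packing under bounded degree, and a vertex to delete -/

theorem path_isContained_of_card_lt {V : Type} [Fintype V] {G : SimpleGraph V}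
    [DecidableRel G.Adj] (h : Fintype.card V < #G.edgeFinset) : P4 ⊑ G := by
  by_contra hG
  have := (card_edgeFinset_le_of_free _ V G rfl hG).1
  omega

theorem star_isContained_of_card_lt [Fintype V] [DecidableRel G.Adj]
    (h : Fintype.card V < #G.edgeFinset) : S3 ⊑ G := by
  classical
  obtain ⟨v, hv⟩ : ∃ v, 3 ≤ G.degree v := by
    by_contra! hd
    have h1 := sum_degrees_eq_twice_card_edges G
    have h2 := sum_le_sum fun v (_ : v ∈ univ) => Nat.le_of_lt_succ (hd v)
    simp at h2
    omega
  obtain ⟨g, -⟩ := exists_starCopy_disjoint_of_degree (X := ∅) (by simp) (by simpa using hv)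
  exact ⟨g⟩

/-- A copy has `4 * (a + b)` vertices, so removing it costs at most `D` times as many edges and
leaves enough to find another component. -/
theorem card_lt_card_edgeFinset_induce_compl_range {a b D : ℕ} [Fintype V] [DecidableRel G.Adj]
    (hD : ∀ v, G.degree v ≤ D) (f : Copy (forest a b) G)
    (h : Fintype.card V + D * (4 * (a + b)) < #G.edgeFinset)
    [Fintype ((Set.range f)ᶜ : Set V)] [Fintype (G.induce (Set.range f)ᶜ).edgeSet] :
    Fintype.card ((Set.range f)ᶜ : Set V) < #(G.induce (Set.range f)ᶜ).edgeFinset := by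
  classical
  have hT : ∀ v, v ∈ (Set.range f)ᶜ ↔ v ∉ univ.image f := by simp
  have h1 := card_edgeFinset_le_induce_add_sum_degree (G := G) hT
  have h2 := card_of_mem_iff_notMem hT
  have h3 : ∑ v ∈ univ.image f, G.degree v ≤ D * (4 * (a + b)) := by
    refine (sum_le_card_nsmul _ _ D fun v _ => hD v).trans ?_
    rw [card_range_copy_forest, smul_eq_mul, mul_comm]
  omega

/-- A graph of bounded degree with more than `|V| + O(1)` edges contains any forest of paths `P₄`
and stars `S₃`. -/
theorem forest_isContained_of_degree_le {V : Type} [Fintype V] {G : SimpleGraph V}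
    [DecidableRel G.Adj] {D : ℕ} (hD : ∀ v, G.degree v ≤ D) (a b : ℕ)
    (h : Fintype.card V + D * (4 * (a + b)) < #G.edgeFinset) : forest a b ⊑ G := by
  classical
  have hmono : ∀ {k l}, k ≤ l → D * (4 * k) ≤ D * (4 * l) := fun h =>
    Nat.mul_le_mul_left _ (Nat.mul_le_mul_left _ h)
  induction b with
  | zero =>
    induction a with
    | zero => exact ⟨emptyCopy G⟩
    | succ a ih =>
      have h' := hmono (show a + 0 ≤ a + 1 + 0 by omega)
      obtain ⟨f⟩ := ih (by omega)
      exact forest_succ_path_isContained_of_induce f (path_isContained_of_card_lt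
        (card_lt_card_edgeFinset_induce_compl_range hD f (by omega)))
  | succ b ih =>
    have h' := hmono (show a + b ≤ a + (b + 1) by omega)
    obtain ⟨f⟩ := ih (by omega)
    exact forest_succ_star_isContained_of_induce f (star_isContained_of_card_lt
      (card_lt_card_edgeFinset_induce_compl_range hD f (by omega)))

/-- A dense enough graph without `a · P₄ ∪ (b + 1) · S₃` has a vertex whose deletion leaves a graph
without `a · P₄ ∪ b · S₃`. -/
theorem exists_forest_free_induce_compl_singleton {V : Type} [Fintype V] {G : SimpleGraph V}
    [DecidableRel G.Adj] {a b : ℕ} (hG : (forest a (b + 1)).Free G)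
    (h : Fintype.card V + (4 * (a + b) + 3) * (4 * (a + (b + 1))) < #G.edgeFinset) :
    ∃ v, (forest a b).Free (G.induce ({v}ᶜ : Set V)) := by
  classical
  -- Such a degree leaves three neighbours outside any copy of `forest a b`, enough for a star at
  -- `v`.
  obtain ⟨v, hv⟩ : ∃ v, 4 * (a + b) + 3 < G.degree v := by
    by_contra! hD
    exact hG (forest_isContained_of_degree_le hD a (b + 1) h)
  refine ⟨v, fun ⟨f⟩ => hG ?_⟩
  let f' := (Copy.induce G _).comp f
  have hf' : ∀ x, f' x ≠ v := fun x => (f x).2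
  obtain ⟨g, hg⟩ := exists_starCopy_disjoint_of_degree (G := G) (v := v) (X := univ.image f')
    (by simpa using hf') (by rw [card_range_copy_forest]; exact hv.le)
  obtain ⟨f'', -⟩ := exists_copy_forest_succ_star f' g (by
    rw [Set.disjoint_right]
    intro x hx
    simpa using hg x hx)
  exact ⟨f''⟩

/-! ### Two vertices with many common neighbours -/

theorem sum_card_le_card_biUnion_add [DecidableEq V] (A : V → Finset W) [DecidableEq W] (C : ℕ)
    (S : Finset V) (h : ∀ u ∈ S, ∀ v ∈ S, u ≠ v → #(A u ∩ A v) ≤ C) :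
    ∑ u ∈ S, #(A u) ≤ #(S.biUnion A) + #S * #S * C := by
  induction S using Finset.induction_on with
  | empty => simp
  | insert s S hs ih =>
    have ih := ih fun u hu v hv => h u (mem_insert_of_mem hu) v (mem_insert_of_mem hv)
    rw [sum_insert hs, biUnion_insert, card_insert_of_notMem hs]
    have h1 := card_union_add_card_inter (A s) (S.biUnion A)
    have h2 : #(A s ∩ S.biUnion A) ≤ #S * C := by
      rw [inter_biUnion]
      refine card_biUnion_le.trans ((sum_le_card_nsmul _ _ C fun v hv => ?_).trans_eq rfl)
      exact h s (mem_insert_self _ _) v (mem_insert_of_mem hv) fun e => hs (e ▸ hv)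
    nlinarith

/-- A largest packing of paths leaves a `P4`-free remainder. -/
theorem exists_copy_induce_free_of_free {a : ℕ} (hG : (forest a 0).Free G) :
    ∃ k, k < a ∧ ∃ f : Copy (forest k 0) G, P4.Free (G.induce (Set.range f)ᶜ) := by
  induction a with
  | zero => exact absurd ⟨emptyCopy G⟩ hG
  | succ a ih =>
    by_cases h : (forest a 0).Free G
    · obtain ⟨k, hk, hf⟩ := ih h
      exact ⟨k, by omega, hf⟩
    · obtain ⟨f⟩ := not_free.1 h
      exact ⟨a, by omega, f, fun hP => hG (forest_succ_path_isContained_of_induce f hP)⟩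

/-- A dense enough graph without `(a + 1) · P₄` has two vertices whose deletion leaves a graph
without `a · P₄`. -/
theorem exists_forest_free_induce_compl_pair {V : Type} [Fintype V] {G : SimpleGraph V}
    [DecidableRel G.Adj] {a : ℕ} (hG : (forest (a + 1) 0).Free G)
    (h : 2 * Fintype.card V + (4 * a) * (4 * a) * (4 * a + 1) < #G.edgeFinset) :
    ∃ u, ∃ v : ({u}ᶜ : Set V),
      (forest a 0).Free ((G.induce ({u}ᶜ : Set V)).induce ({v}ᶜ : Set ({u}ᶜ : Set V))) := by
  classical
  obtain ⟨k, hk, f, hf⟩ := exists_copy_induce_free_of_free hG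
  have hT : ∀ v, v ∈ (Set.range f)ᶜ ↔ v ∉ univ.image f := by simp
  have h1 := card_edgeFinset_le_induce_add_sum_degree (G := G) hT
  have h2 := (card_edgeFinset_le_of_free _ _ _ rfl hf).1
  rw [card_of_mem_iff_notMem hT] at h2
  have hc := card_range_copy_forest f
  -- The `P4`-free remainder carries at most `|V|` edges, so the at most `4 * a` packed vertices
  -- have degree sum well above `|V|` and two neighbourhoods overlap a lot. More than `4 * a + 1`
  -- common neighbours leave two outside any copy of `forest a 0`.
  obtain ⟨u, v, huv, hcommon⟩ : ∃ u v, u ≠ v ∧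
      4 * a + 1 < #(G.neighborFinset u ∩ G.neighborFinset v) := by
    by_contra! hno
    have h3 := sum_card_le_card_biUnion_add (fun v => G.neighborFinset v) (4 * a + 1)
      (univ.image f) fun u _ v _ huv => hno u v huv
    simp only [card_neighborFinset_eq_degree] at h3
    have h4 : #((univ.image f).biUnion fun v => G.neighborFinset v) ≤ Fintype.card V :=
      card_le_univ _
    have h5 : #(univ.image f) * #(univ.image f) * (4 * a + 1) ≤
        (4 * a) * (4 * a) * (4 * a + 1) := by
      have : #(univ.image f) ≤ 4 * a := by omega
      gcongr
    omega
  refine ⟨u, ⟨v, huv.symm⟩, fun ⟨g⟩ => hG ?_⟩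
  let g' := (Copy.induce G _).comp ((Copy.induce _ _).comp g)
  have hu : ∀ x, g' x ≠ u := fun x => (g x).1.2
  have hv : ∀ x, g' x ≠ v := fun x e => (g x).2 (Subtype.ext e)
  have h3 : 1 < #((G.neighborFinset u ∩ G.neighborFinset v) \ univ.image g') := by
    have := le_card_sdiff (univ.image g') (G.neighborFinset u ∩ G.neighborFinset v)
    rw [card_range_copy_forest] at this
    omega
  obtain ⟨x, hx, y, hy, hxy⟩ := one_lt_card.1 h3
  simp only [mem_sdiff, mem_inter, mem_neighborFinset, mem_image, mem_univ, true_and,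
    not_exists] at hx hy
  obtain ⟨g'', -⟩ := exists_copy_forest_succ_path g'
    (pathCopy hx.1.1.symm hy.1.1 hy.1.2.symm hxy hx.1.2.ne' huv) (by
      rw [Set.disjoint_right, range_pathCopy]
      rintro _ (rfl | rfl | rfl | rfl) ⟨z, hz⟩
      exacts [hx.2 z hz, hu z hz, hy.2 z hz, hv z hz])
  exact ⟨g''⟩

end LargeDegree

/-! ### Adding a universal vertex -/

theorem card_edgeFinset_bot {V : Type*} {_ : Fintype (⊥ : SimpleGraph V).edgeSet} :
    #(⊥ : SimpleGraph V).edgeFinset = 0 :=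
  card_eq_zero.2 (edgeFinset_eq_empty.2 rfl)

section Step

variable {V W : Type*} {G : SimpleGraph V} [Fintype V] [DecidableRel G.Adj]

/-- The increment `k + w` is the degree of the additional universal vertex. -/
theorem choose_two_succ_add (k w e : ℕ) :
    (k + 1).choose 2 + (k + 1) * w + e = k.choose 2 + k * w + e + (k + w) := by
  rw [Nat.choose_succ_succ' k 1, Nat.choose_one_right]
  ring

/-- Any vertex has degree at most `k + w`, so the lower bound on the edges passes to the induction
hypothesis. -/
theorem card_edgeFinset_induce_ge {k w e : ℕ} (v : V) (hV : Fintype.card V = k + 1 + w)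
    (he : (k + 1).choose 2 + (k + 1) * w + e ≤ #G.edgeFinset)
    [Fintype (G.induce ({v}ᶜ : Set V)).edgeSet] :
    k.choose 2 + k * w + e ≤ #(G.induce ({v}ᶜ : Set V)).edgeFinset := by
  have h1 := card_edgeFinset_le_induce_add_degree (G := G) v
  have h2 := G.degree_lt_card_verts v
  rw [choose_two_succ_add] at he
  omega

/-- If deleting a vertex of a dense enough graph leaves a join with `k` universal vertices, then the
deleted vertex is universal as well. -/
theorem nonempty_iso_addUniversal_succ_of_card_le [Fintype W] {k : ℕ} {H : SimpleGraph W}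
    [DecidableRel H.Adj] {v : V}
    (φ : Nonempty (G.induce ({v}ᶜ : Set V) ≃g addUniversal k H))
    (hV : Fintype.card V = k + 1 + Fintype.card W)
    (he : (k + 1).choose 2 + (k + 1) * Fintype.card W + #H.edgeFinset ≤ #G.edgeFinset) :
    Nonempty (G ≃g addUniversal (k + 1) H) := by
  classical
  obtain ⟨φ⟩ := φ
  have h1 := card_edgeFinset_le_induce_add_degree (G := G) v
  rw [φ.card_edgeFinset_eq, card_edgeFinset_addUniversal] at h1
  rw [choose_two_succ_add] at he
  exact nonempty_iso_addUniversal_succ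
    (fun x hx => adj_of_card_le_degree_add_one (by omega) hx) φ

theorem nonempty_iso_addUniversal_bot_succ_of_card_le {k m : ℕ} {v : V}
    (φ : Nonempty (G.induce ({v}ᶜ : Set V) ≃g addUniversal k (⊥ : SimpleGraph (Fin m))))
    (hV : Fintype.card V = k + 1 + m)
    (he : (k + 1).choose 2 + (k + 1) * m ≤ #G.edgeFinset) :
    Nonempty (G ≃g addUniversal (k + 1) (⊥ : SimpleGraph (Fin m))) := by
  classical
  refine nonempty_iso_addUniversal_succ_of_card_le φ (by rwa [Fintype.card_fin]) ?_
  rw [Fintype.card_fin]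
  exact (Nat.add_left_cancel_iff.2 card_edgeFinset_bot).le.trans he

end Step

/-! ### Two or more paths -/

/-- With all degrees at most two, every edge meets a fixed edge `pq`, giving at most four edges.
Otherwise some `c` has degree at least three, and an edge avoiding `c` cannot meet three edges at
`c`. -/
theorem exists_forall_edge_of_pairwise_intersecting {V : Type*} [Fintype V] {G : SimpleGraph V}
    [DecidableRel G.Adj]
    (h : ∀ w x y z, G.Adj w x → G.Adj y z → w = y ∨ w = z ∨ x = y ∨ x = z)
    (he : 4 < #G.edgeFinset) : ∃ c, ∀ x y, G.Adj x y → x = c ∨ y = c := by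
  classical
  obtain ⟨c, hc⟩ : ∃ c, 3 ≤ G.degree c := by
    by_contra! hd
    have h0 : G.edgeFinset.Nonempty := card_pos.1 (by omega)
    obtain ⟨e, he'⟩ := h0
    induction e with | _ p q => ?_
    rw [mem_edgeFinset, mem_edgeSet] at he'
    have h1 := card_edgeFinset_le_induce_add_sum_degree (G := G) (S := {p, q})
      (T := {v | v ∉ ({p, q} : Finset V)}) (by simp)
    rw [sum_pair he'.ne] at h1
    have h2 : #(G.induce {v | v ∉ ({p, q} : Finset V)}).edgeFinset = 0 := by
      rw [card_eq_zero, edgeFinset_eq_empty]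
      ext ⟨x, hx⟩ ⟨y, hy⟩
      simp only [comap_adj, bot_adj, iff_false, Function.Embedding.subtype_apply]
      intro hxy
      simp only [Set.mem_ofPred_eq, mem_insert, mem_singleton, not_or] at hx hy
      rcases h x y p q hxy he' with e | e | e | e
      exacts [hx.1 e, hx.2 e, hy.1 e, hy.2 e]
    have h3 := hd p
    have h4 := hd q
    omega
  refine ⟨c, fun y z hyz => ?_⟩
  by_contra! hn
  obtain ⟨w, hw, hwy, hwz⟩ := exists_adj_ne_ne_of_three_le_degree hc y z
  rcases h c w y z hw hyz with e | e | e | e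
  exacts [hn.1 e.symm, hn.2 e.symm, hwy e, hwz e]

/-- The remainder has at most `m + 1` edges, so `u`, and `v` in `G - u`, each miss at most one
vertex. Two disjoint edges of the remainder would be extended to disjoint paths by `v` and by `u`.
The bound `6 ≤ m` gives `u` degree at least 7: four vertices to avoid, plus three. -/
theorem nonempty_iso_of_two_paths_free {V : Type} [Fintype V] {G : SimpleGraph V}
    [DecidableRel G.Adj] {m : ℕ} (hm : 6 ≤ m) (hV : Fintype.card V = 3 + m)
    (hG : (forest 2 0).Free G) (he : Nat.choose 3 2 + 3 * m ≤ #G.edgeFinset)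
    {u : V} {v : ({u}ᶜ : Set V)}
    (huv : (forest 1 0).Free ((G.induce ({u}ᶜ : Set V)).induce ({v}ᶜ : Set ({u}ᶜ : Set V)))) :
    Nonempty ((G.induce ({u}ᶜ : Set V)).induce ({v}ᶜ : Set ({u}ᶜ : Set V)) ≃g
      addUniversal 1 (⊥ : SimpleGraph (Fin m))) := by
  classical
  have hfree : P4.Free ((G.induce ({u}ᶜ : Set V)).induce ({v}ᶜ : Set ({u}ᶜ : Set V))) :=
    fun h => huv (forest_one_zero_isContained_iff.2 h)
  have hV1 : Fintype.card ({u}ᶜ : Set V) = 2 + m := by rw [card_compl_singleton]; omega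
  have hV2 : Fintype.card ({v}ᶜ : Set ({u}ᶜ : Set V)) = m + 1 := by
    rw [card_compl_singleton]; omega
  have h1 := card_edgeFinset_le_induce_add_degree (G := G) u
  have h2 := card_edgeFinset_le_induce_add_degree (G := G.induce ({u}ᶜ : Set V)) v
  have h3 := (card_edgeFinset_le_of_free _ _ _ hV2 hfree).1
  have h4 := G.degree_lt_card_verts u
  have h5 := (G.induce ({u}ᶜ : Set V)).degree_lt_card_verts v
  have h6 : Nat.choose 3 2 = 3 := rfl
  obtain ⟨c, hc⟩ := exists_forall_edge_of_pairwise_intersecting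
    (G := (G.induce ({u}ᶜ : Set V)).induce ({v}ᶜ : Set ({u}ᶜ : Set V))) (by
      intro w x y z hwx hyz
      by_contra! hne
      obtain ⟨g₁, hg₁⟩ := exists_pathCopy_disjoint_of_degree
        (G := G.induce ({u}ᶜ : Set V)) (v := v) (X := {w.1, x.1}) hyz y.2 z.2 (by omega)
        (by
          simp only [mem_insert, mem_singleton, not_or]
          exact ⟨fun e => w.2 e.symm, fun e => x.2 e.symm⟩)
        (by
          simp only [mem_insert, mem_singleton, not_or]
          exact ⟨fun e => hne.1 (Subtype.ext e.symm), fun e => hne.2.2.1 (Subtype.ext e.symm)⟩)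
        (by
          simp only [mem_insert, mem_singleton, not_or]
          exact ⟨fun e => hne.2.1 (Subtype.ext e.symm), fun e => hne.2.2.2 (Subtype.ext e.symm)⟩)
        (by have := card_le_two (a := w.1) (b := x.1); omega)
      let g₁' := (Copy.induce G _).comp g₁
      have hX : #(univ.image g₁') ≤ 4 := card_image_le
      obtain ⟨g₂, hg₂⟩ := exists_pathCopy_disjoint_of_degree
        (G := G) (v := u) (y := w.1.1) (z := x.1.1) (X := univ.image g₁') hwx w.1.2 x.1.2 (by omega)
        (by
          simp only [mem_image, mem_univ, true_and, not_exists]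
          exact fun i => (g₁ i).2)
        (by
          simp only [mem_image, mem_univ, true_and, not_exists]
          exact fun i e => hg₁ _ ⟨i, rfl⟩ (by
            simp [show g₁ i = w.1 from Subtype.ext e]))
        (by
          simp only [mem_image, mem_univ, true_and, not_exists]
          exact fun i e => hg₁ _ ⟨i, rfl⟩ (by
            simp [show g₁ i = x.1 from Subtype.ext e]))
        (by omega)
      obtain ⟨f, hf⟩ := exists_copy_forest_one_zero g₁'
      obtain ⟨f', -⟩ := exists_copy_forest_succ_path f g₂ (by
        rw [Set.disjoint_right]
        intro p hp hpf
        have := hf hpf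
        exact hg₂ p hp (by simpa using this))
      exact hG ⟨f'⟩) (by omega)
  exact nonempty_iso_star_of_forall_edge hc hV2 (by omega)

theorem exists_nonempty_iso_of_paths_free (a : ℕ) : ∃ N, ∀ m, N ≤ m → ∀ (V : Type) [Fintype V]
    (G : SimpleGraph V) [DecidableRel G.Adj], Fintype.card V = 2 * a + 3 + m →
    (forest (a + 2) 0).Free G → (2 * a + 3).choose 2 + (2 * a + 3) * m ≤ #G.edgeFinset →
    Nonempty (G ≃g addUniversal (2 * a + 3) (⊥ : SimpleGraph (Fin m))) := by
  classical
  obtain ⟨N, hN⟩ : ∃ N, ∀ m, N ≤ m → ∀ (V : Type) [Fintype V]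
      (G : SimpleGraph V) [DecidableRel G.Adj], Fintype.card V = 2 * a + 3 + m →
      (forest (a + 2) 0).Free G → (2 * a + 3).choose 2 + (2 * a + 3) * m ≤ #G.edgeFinset →
      ∀ (u : V) (v : ({u}ᶜ : Set V)), (forest (a + 1) 0).Free
        ((G.induce ({u}ᶜ : Set V)).induce ({v}ᶜ : Set ({u}ᶜ : Set V))) →
      Nonempty ((G.induce ({u}ᶜ : Set V)).induce ({v}ᶜ : Set ({u}ᶜ : Set V)) ≃g
        addUniversal (2 * a + 1) (⊥ : SimpleGraph (Fin m))) := by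
    cases a with
    | zero =>
      exact ⟨6, fun m hm V _ G _ hV hG he u v huv =>
        nonempty_iso_of_two_paths_free hm (by omega) hG he huv⟩
    | succ a =>
      obtain ⟨N, hN⟩ := exists_nonempty_iso_of_paths_free a
      refine ⟨N, fun m hm V _ G _ hV hG he u v huv => ?_⟩
      refine hN m hm _ _ ?_ huv ?_
      · rw [card_compl_singleton, card_compl_singleton]
        omega
      · have h1 := card_edgeFinset_induce_ge (G := G) (k := 2 * (a + 1) + 2) (w := m) (e := 0)
          u (by omega) he
        exact card_edgeFinset_induce_ge (k := 2 * a + 3) (w := m) (e := 0) v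
          (by rw [card_compl_singleton]; omega) h1
  refine ⟨max N (2 * (2 * a + 3) + (4 * (a + 1)) * (4 * (a + 1)) * (4 * (a + 1) + 1) + 1),
    fun m hm V _ G _ hV hG he => ?_⟩
  -- At least `3 * m` edges beat the `2 * |V| + O(1)` needed to find `u` and `v`.
  have h3 : 3 * m ≤ (2 * a + 3) * m := Nat.mul_le_mul_right m (by omega)
  obtain ⟨u, v, huv⟩ := exists_forest_free_induce_compl_pair hG (by omega)
  have h4 := card_edgeFinset_induce_ge (G := G) (k := 2 * a + 2) (w := m) (e := 0) u (by omega) he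
  refine nonempty_iso_addUniversal_bot_succ_of_card_le (v := u)
    (nonempty_iso_addUniversal_bot_succ_of_card_le (v := v)
      (hN m (by omega) V G hV hG he u v huv) ?_ h4) (by omega) he
  rw [card_compl_singleton]
  omega

theorem exists_nonempty_iso_of_forest_free (a b : ℕ) : ∃ N, ∀ m, N ≤ m → ∀ (V : Type) [Fintype V]
    (G : SimpleGraph V) [DecidableRel G.Adj], Fintype.card V = 2 * a + 3 + b + m →
    (forest (a + 2) b).Free G → (2 * a + 3 + b).choose 2 + (2 * a + 3 + b) * m ≤ #G.edgeFinset →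
    Nonempty (G ≃g addUniversal (2 * a + 3 + b) (⊥ : SimpleGraph (Fin m))) := by
  classical
  induction b with
  | zero => exact exists_nonempty_iso_of_paths_free a
  | succ b ih =>
    obtain ⟨N, hN⟩ := ih
    refine ⟨max N (2 * a + 3 + (b + 1) + (4 * (a + 2 + b) + 3) * (4 * (a + 2 + (b + 1))) + 1),
      fun m hm V _ G _ hV hG he => ?_⟩
    have h2 : 2 * m ≤ (2 * a + 3 + (b + 1)) * m := Nat.mul_le_mul_right m (by omega)
    obtain ⟨v, hv⟩ := exists_forest_free_induce_compl_singleton hG (by omega)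
    refine nonempty_iso_addUniversal_bot_succ_of_card_le (v := v)
      (hN m (by omega) _ _ ?_ hv ?_) (by omega) he
    · rw [card_compl_singleton]; omega
    · exact card_edgeFinset_induce_ge (k := 2 * a + 3 + b) (w := m) (e := 0) v (by omega) he

/-! ### A single path -/

theorem card_cliquesGraph (r d : ℕ) : Fintype.card (Fin r ⊕ Fin d × Fin 3) = 3 * d + r := by
  simp; ring

theorem exists_nonempty_iso_of_path_stars_free (b : ℕ) : ∃ N, ∀ d, N ≤ d →
    ∀ (V : Type) [Fintype V] (G : SimpleGraph V) [DecidableRel G.Adj],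
    Fintype.card V = b + 3 * d → (forest 1 b).Free G →
    b.choose 2 + b * (3 * d) + 3 * d ≤ #G.edgeFinset →
    Nonempty (G ≃g addUniversal b (cliquesGraph 0 d)) := by
  classical
  induction b with
  | zero =>
    refine ⟨0, fun d _ V _ G _ hV hG he => ?_⟩
    have hfree : P4.Free G := fun h => hG (forest_one_zero_isContained_iff.2 h)
    have h1 := card_edgeFinset_le_of_free _ V G rfl hfree
    simp only [Nat.choose_zero_succ, zero_mul, zero_add] at he hV
    obtain ⟨d', hd', ⟨φ⟩⟩ := exists_iso_disjointCopies_of_free hfree (h1.2 (by omega))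
    obtain rfl : d = d' := by omega
    let ψ : disjointCopies d (⊤ : SimpleGraph (Fin 3)) ≃g cliquesGraph 0 d :=
      ⟨(Equiv.emptySum (Fin 0) _).symm, Iff.rfl⟩
    exact ⟨(φ.trans ψ).trans (nonempty_iso_addUniversal_zero _).some⟩
  | succ b ih =>
    obtain ⟨N, hN⟩ := ih
    refine ⟨max N (b + 1 + (4 * (1 + b) + 3) * (4 * (1 + (b + 1))) + 1),
      fun d hd V _ G _ hV hG he => ?_⟩
    have h2 : 1 * (3 * d) ≤ (b + 1) * (3 * d) := Nat.mul_le_mul_right _ (by omega)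
    obtain ⟨v, hv⟩ := exists_forest_free_induce_compl_singleton hG (by omega)
    refine nonempty_iso_addUniversal_succ_of_card_le (v := v)
      (hN d (by omega) _ _ ?_ hv ?_) ?_ ?_
    · rw [card_compl_singleton]; omega
    · exact card_edgeFinset_induce_ge (w := 3 * d) (e := 3 * d) v (by omega) he
    · rw [card_cliquesGraph]; omega
    · rw [card_cliquesGraph, card_edgeFinset_cliquesGraph]
      simpa using he

/-- The component of `c` in `G - v` is a star. An edge not at `c` lies outside it, and the universal
vertex `v` extends that edge to a path avoiding an `S3` at `c`. -/
theorem forall_edge_of_path_star_free {V : Type*} [Fintype V] {G : SimpleGraph V}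
    [DecidableRel G.Adj] {v : V} (hG : (forest 1 1).Free G)
    (hv : Fintype.card V ≤ G.degree v + 1) (hV : 8 ≤ Fintype.card V) {c : ({v}ᶜ : Set V)}
    [Fintype ((G.induce ({v}ᶜ : Set V)).neighborSet c)]
    (hdeg : 3 ≤ (G.induce ({v}ᶜ : Set V)).degree c)
    (hc : ∀ x, (G.induce ({v}ᶜ : Set V)).Adj c x →
      ∀ y, (G.induce ({v}ᶜ : Set V)).Adj x y → y = c)
    (y z : ({v}ᶜ : Set V)) (hyz : (G.induce ({v}ᶜ : Set V)).Adj y z) : y = c ∨ z = c := by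
  classical
  by_contra! hn
  have hy : ¬ (G.induce ({v}ᶜ : Set V)).Adj c y := fun h => hn.2 (hc y h z hyz)
  have hz : ¬ (G.induce ({v}ᶜ : Set V)).Adj c z := fun h => hn.1 (hc z h y hyz.symm)
  obtain ⟨p, q, r, hp, hq, hr, hpq, hpr, hqr⟩ := two_lt_card_iff.1
    (show 2 < #((G.induce ({v}ᶜ : Set V)).neighborFinset c) by
      rw [card_neighborFinset_eq_degree]; exact hdeg)
  rw [mem_neighborFinset] at hp hq hr
  let s : Copy S3 G := (Copy.induce G _).comp (starCopy hp hq hr hpq hpr hqr)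
  have hs : ∀ i, starCopy hp hq hr hpq hpr hqr i = c ∨
      (G.induce ({v}ᶜ : Set V)).Adj c (starCopy hp hq hr hpq hpr hqr i) := by
    intro i
    have h : starCopy hp hq hr hpq hpr hqr i ∈ Set.range (starCopy hp hq hr hpq hpr hqr) := ⟨i, rfl⟩
    rw [range_starCopy] at h
    rcases h with h | h | h | h <;> rw [h]
    exacts [Or.inl rfl, Or.inr hp, Or.inr hq, Or.inr hr]
  have hX : #(univ.image s) ≤ 4 := card_image_le
  obtain ⟨g, hg⟩ := exists_pathCopy_disjoint_of_degree (G := G) (v := v) (y := y.1) (z := z.1)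
    (X := univ.image s) hyz y.2 z.2 (by omega)
    (by
      simp only [mem_image, mem_univ, true_and, not_exists]
      exact fun i => (starCopy hp hq hr hpq hpr hqr i).2)
    (by
      simp only [mem_image, mem_univ, true_and, not_exists]
      intro i e
      have e := Subtype.ext (a2 := y) e
      rcases hs i with h | h
      exacts [hn.1 (e.symm.trans h), hy (e ▸ h)])
    (by
      simp only [mem_image, mem_univ, true_and, not_exists]
      intro i e
      have e := Subtype.ext (a2 := z) e
      rcases hs i with h | h
      exacts [hn.2 (e.symm.trans h), hz (e ▸ h)])
    (by omega)
  obtain ⟨f, hf⟩ := exists_copy_forest_one_zero g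
  obtain ⟨f', -⟩ := exists_copy_forest_succ_star f s (by
    rw [Set.disjoint_left]
    intro x hx hxs
    exact hg x (hf hx) (by simpa using hxs))
  exact hG ⟨f'⟩

/-- For `r` equal to 1 or 2, `r.choose 2 = r - 1`; hence the tie with a star on the same vertices.
-/
theorem card_edgeFinset_cliquesGraph_of_ne_zero {r : ℕ} (hr0 : r ≠ 0) (hr : r ≤ 2) (d : ℕ)
    [Fintype (cliquesGraph r d).edgeSet] :
    #(cliquesGraph r d).edgeFinset = 3 * d + r - 1 := by
  rw [card_edgeFinset_cliquesGraph]
  obtain rfl | rfl : r = 1 ∨ r = 2 := by omega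
  · simp
  · simp; omega

theorem choose_two_add_of_pos {k w : ℕ} (hw : 1 ≤ w) :
    (k + 1).choose 2 + (k + 1) * (w - 1) = k.choose 2 + k * w + (w - 1) := by
  obtain ⟨w, rfl⟩ := Nat.exists_eq_add_of_le' hw
  rw [Nat.choose_succ_succ' k 1, Nat.choose_one_right, Nat.add_sub_cancel]
  ring

/-- The induction starts with one star: without stars, a star together with triangles would also be
extremal. -/
theorem exists_nonempty_iso_or_of_path_stars_free (b : ℕ) : ∃ N, ∀ d r, N ≤ d → r ≠ 0 → r ≤ 2 →
    ∀ (V : Type) [Fintype V] (G : SimpleGraph V) [DecidableRel G.Adj],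
    Fintype.card V = b + 1 + (3 * d + r) → (forest 1 (b + 1)).Free G →
    (b + 1).choose 2 + (b + 1) * (3 * d + r) + (3 * d + r - 1) ≤ #G.edgeFinset →
    Nonempty (G ≃g addUniversal (b + 1) (cliquesGraph r d)) ∨
      Nonempty (G ≃g addUniversal (b + 1 + 1) (⊥ : SimpleGraph (Fin (3 * d + r - 1)))) := by
  classical
  obtain ⟨N, hN⟩ : ∃ N, ∀ d r, N ≤ d → r ≠ 0 → r ≤ 2 →
      ∀ (V : Type) [Fintype V] (G : SimpleGraph V) [DecidableRel G.Adj],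
      Fintype.card V = b + 1 + (3 * d + r) → (forest 1 (b + 1)).Free G →
      (b + 1).choose 2 + (b + 1) * (3 * d + r) + (3 * d + r - 1) ≤ #G.edgeFinset →
      ∀ v, (forest 1 b).Free (G.induce ({v}ᶜ : Set V)) →
      Nonempty (G.induce ({v}ᶜ : Set V) ≃g addUniversal b (cliquesGraph r d)) ∨
        Nonempty (G.induce ({v}ᶜ : Set V) ≃g
          addUniversal (b + 1) (⊥ : SimpleGraph (Fin (3 * d + r - 1)))) := by
    cases b with
    | zero =>
      refine ⟨3, fun d r hd hr0 hr V _ G _ hV hG he v hv => ?_⟩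
      have hfree : P4.Free (G.induce ({v}ᶜ : Set V)) := fun h =>
        hv (forest_one_zero_isContained_iff.2 h)
      have h1 := card_edgeFinset_induce_ge (k := 0) (w := 3 * d + r) v hV he
      have hV' : Fintype.card ({v}ᶜ : Set V) = 3 * d + r := by rw [card_compl_singleton]; omega
      have h2 := card_edgeFinset_le_of_free _ _ _ hV' hfree
      -- Equality would make the order divisible by 3. So `G - v` has exactly `3 * d + r - 1` edges,
      -- and `v` must be universal.
      have h3 : #(G.induce ({v}ᶜ : Set V)).edgeFinset ≠ 3 * d + r := by
        intro h
        obtain ⟨d', hd', -⟩ := exists_iso_disjointCopies_of_free hfree (h2.2 h)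
        omega
      simp only [Nat.choose_zero_succ, zero_mul, zero_add] at h1
      rcases nonempty_iso_cliquesGraph_or_exists hr0 hr hV' hfree (by omega) with
        ⟨⟨φ⟩⟩ | ⟨c, hdeg, hc⟩
      · exact Or.inl ⟨φ.trans (nonempty_iso_addUniversal_zero _).some⟩
      · have h4 := card_edgeFinset_le_induce_add_degree (G := G) v
        simp only [zero_add, one_mul, show Nat.choose 1 2 = 0 from rfl] at he
        exact Or.inr (nonempty_iso_star_of_forall_edge
          (forall_edge_of_path_star_free hG (by omega) (by omega) hdeg hc) (by omega) (by omega))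
    | succ b =>
      obtain ⟨N, hN⟩ := exists_nonempty_iso_or_of_path_stars_free b
      refine ⟨N, fun d r hd hr0 hr V _ G _ hV hG he v hv => ?_⟩
      exact hN d r hd hr0 hr _ _ (by rw [card_compl_singleton]; omega) hv
        (card_edgeFinset_induce_ge (k := b + 1) (w := 3 * d + r) v (by omega) he)
  refine ⟨max N (b + 3 + (4 * (1 + b) + 3) * (4 * (1 + (b + 1))) + 1),
    fun d r hd hr0 hr V _ G _ hV hG he => ?_⟩
  have h2 : 1 * (3 * d + r) ≤ (b + 1) * (3 * d + r) := Nat.mul_le_mul_right _ (by omega)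
  obtain ⟨v, hv⟩ := exists_forest_free_induce_compl_singleton hG (by omega)
  refine (hN d r (by omega) hr0 hr V G hV hG he v hv).imp (fun φ => ?_) fun φ => ?_
  · refine nonempty_iso_addUniversal_succ_of_card_le φ ?_ ?_
    · rw [card_cliquesGraph, hV]
    · rw [card_cliquesGraph, card_edgeFinset_cliquesGraph_of_ne_zero hr0 hr]
      exact he
  · refine nonempty_iso_addUniversal_bot_succ_of_card_le φ (by omega) ?_
    rw [choose_two_add_of_pos (by omega)]
    exact he

/-! ### Extremal graphs -/

/-- Existence in `h₃` ensures that the value `E` is attained, so extremal graphs have at least `E`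
edges. -/
theorem isExtremal_iff_of_forall {n E : ℕ} {U : Type*} {F : SimpleGraph U}
    {P : SimpleGraph (Fin n) → Prop}
    (h₁ : ∀ (G : SimpleGraph (Fin n)) [DecidableRel G.Adj],
      P G → F.Free G ∧ #G.edgeFinset = E)
    (h₂ : ∀ (G : SimpleGraph (Fin n)) [DecidableRel G.Adj],
      F.Free G → E ≤ #G.edgeFinset → P G)
    (h₃ : ∃ G, P G) (G : SimpleGraph (Fin n)) [DecidableRel G.Adj] :
    G.IsExtremal F.Free ↔ P G := by
  classical
  constructor
  · rintro ⟨hG, hmax⟩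
    obtain ⟨G', hG'⟩ := h₃
    obtain ⟨h4, h5⟩ := h₁ G' hG'
    exact h₂ G hG (h5 ▸ hmax h4)
  · intro hG
    obtain ⟨h4, h5⟩ := h₁ G hG
    refine ⟨h4, fun G' _ hG' => ?_⟩
    by_contra! h
    have := (h₁ G' (h₂ G' hG' (by omega))).2
    omega

theorem free_and_card_edgeFinset_eq_of_iso {n E : ℕ} {U W : Type*} [Fintype W] {F : SimpleGraph U}
    {X : SimpleGraph W} [DecidableRel X.Adj] (hX : F.Free X) (hE : #X.edgeFinset = E)
    (G : SimpleGraph (Fin n)) [DecidableRel G.Adj] (φ : Nonempty (G ≃g X)) :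
    F.Free G ∧ #G.edgeFinset = E :=
  ⟨(free_congr_right φ.some).2 hX, φ.some.card_edgeFinset_eq.trans hE⟩

theorem exists_nonempty_iso {n : ℕ} {W : Type*} [Fintype W] (X : SimpleGraph W)
    (h : Fintype.card W = n) : ∃ G : SimpleGraph (Fin n), Nonempty (G ≃g X) :=
  ⟨X.overFin h, ⟨(X.overFinIso h).symm⟩⟩

theorem nonempty_iso_graphOne_iff {V : Type*} {G : SimpleGraph V} {b n d r : ℕ}
    (hr : (n - b) % 3 = r) (hd : (n - b) / 3 = d) :
    Nonempty (G ≃g graphOne b n) ↔ Nonempty (G ≃g addUniversal b (cliquesGraph r d)) := by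
  subst hr hd
  rfl

theorem nonempty_iso_graphTwo_iff {V : Type*} {G : SimpleGraph V} {a b n k m : ℕ}
    (hk : 2 * a + b - 1 = k) (hm : n - k = m) :
    Nonempty (G ≃g graphTwo a b n) ↔
      Nonempty (G ≃g addUniversal k (⊥ : SimpleGraph (Fin m))) := by
  subst hk hm
  rfl

theorem free_and_card_edgeFinset_eq_of_iso_addUniversal_bot {n a b k m : ℕ} (hk : k < 2 * a + b)
    (G : SimpleGraph (Fin n)) [DecidableRel G.Adj]
    (φ : Nonempty (G ≃g addUniversal k (⊥ : SimpleGraph (Fin m)))) :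
    (forest a b).Free G ∧ #G.edgeFinset = k.choose 2 + k * m := by
  classical
  refine free_and_card_edgeFinset_eq_of_iso (forest_free_addUniversal_bot hk) ?_ G φ
  rw [card_edgeFinset_addUniversal, Fintype.card_fin]
  exact Nat.add_left_cancel_iff.2 card_edgeFinset_bot

theorem free_and_card_edgeFinset_eq_of_iso_addUniversal_cliquesGraph {n a k r d : ℕ}
    (ha : 0 < a) (hr : r ≤ 3) (G : SimpleGraph (Fin n)) [DecidableRel G.Adj]
    (φ : Nonempty (G ≃g addUniversal k (cliquesGraph r d))) :
    (forest a k).Free G ∧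
      #G.edgeFinset = k.choose 2 + k * (3 * d + r) + (r.choose 2 + 3 * d) := by
  classical
  refine free_and_card_edgeFinset_eq_of_iso
    (forest_free_addUniversal_cliquesGraph hr (by omega)) ?_ G φ
  rw [card_edgeFinset_addUniversal, card_cliquesGraph, card_edgeFinset_cliquesGraph]

theorem exists_isExtremal_iff_of_divisible (b : ℕ) : ∃ N, ∀ n d, N ≤ d → n = b + 3 * d →
    ∀ (G : SimpleGraph (Fin n)) [DecidableRel G.Adj],
      G.IsExtremal (forest 1 b).Free ↔ Nonempty (G ≃g addUniversal b (cliquesGraph 0 d)) := by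
  obtain ⟨N, hN⟩ := exists_nonempty_iso_of_path_stars_free b
  refine ⟨N, fun n d hd hn => ?_⟩
  refine isExtremal_iff_of_forall (E := b.choose 2 + b * (3 * d) + 3 * d) (fun G _ φ => ?_)
    (fun G _ hG he => hN d hd _ G (by simpa using hn) hG he) (exists_nonempty_iso _ ?_)
  · simpa using free_and_card_edgeFinset_eq_of_iso_addUniversal_cliquesGraph one_pos
      (Nat.zero_le 3) G φ
  · rw [Fintype.card_sum, card_cliquesGraph, Fintype.card_fin, hn]; rfl

theorem exists_isExtremal_iff_of_not_divisible (b : ℕ) : ∃ N, ∀ n d r, N ≤ d → r ≠ 0 → r ≤ 2 →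
    n = b + 1 + (3 * d + r) → ∀ (G : SimpleGraph (Fin n)) [DecidableRel G.Adj],
      G.IsExtremal (forest 1 (b + 1)).Free ↔
        Nonempty (G ≃g addUniversal (b + 1) (cliquesGraph r d)) ∨
          Nonempty (G ≃g addUniversal (b + 1 + 1) (⊥ : SimpleGraph (Fin (3 * d + r - 1)))) := by
  obtain ⟨N, hN⟩ := exists_nonempty_iso_or_of_path_stars_free b
  refine ⟨N, fun n d r hd hr0 hr hn => ?_⟩
  refine isExtremal_iff_of_forall
    (E := (b + 1).choose 2 + (b + 1) * (3 * d + r) + (3 * d + r - 1)) ?_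
    (fun G _ hG he => hN d r hd hr0 hr _ G (by simpa using hn) hG he) ?_
  · rintro G _ (φ | φ)
    · have h := free_and_card_edgeFinset_eq_of_iso_addUniversal_cliquesGraph one_pos
        (by omega) G φ
      refine ⟨h.1, h.2.trans ?_⟩
      obtain rfl | rfl : r = 1 ∨ r = 2 := by omega
      · simp
      · simp; omega
    · rw [← choose_two_add_of_pos (by omega)]
      exact free_and_card_edgeFinset_eq_of_iso_addUniversal_bot (by omega) G φ
  · obtain ⟨G, hG⟩ := exists_nonempty_iso (n := n) (addUniversal (b + 1) (cliquesGraph r d))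
      (by rw [Fintype.card_sum, card_cliquesGraph, Fintype.card_fin, hn])
    exact ⟨G, Or.inl hG⟩

theorem exists_isExtremal_iff_of_two_le (a b : ℕ) : ∃ N, ∀ n m, N ≤ m →
    n = 2 * a + 3 + b + m → ∀ (G : SimpleGraph (Fin n)) [DecidableRel G.Adj],
      G.IsExtremal (forest (a + 2) b).Free ↔
        Nonempty (G ≃g addUniversal (2 * a + 3 + b) (⊥ : SimpleGraph (Fin m))) := by
  obtain ⟨N, hN⟩ := exists_nonempty_iso_of_forest_free a b
  refine ⟨N, fun n m hm hn => ?_⟩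
  refine isExtremal_iff_of_forall
    (fun G _ φ => free_and_card_edgeFinset_eq_of_iso_addUniversal_bot (by omega) G φ)
    (fun G _ hG he => hN m hm _ G (by simpa using hn) hG he) (exists_nonempty_iso _ ?_)
  rw [Fintype.card_sum, Fintype.card_fin, Fintype.card_fin, hn]

end OrderFourForest

/-- The extremal graphs for `F = a · P₄ ∪ b · S₃` on `n` vertices, `n` large in terms of
`a` and `b`, where `n - b = 3 d + r` and `r ≤ 2`. -/
theorem mainTheorem4 (a b : ℕ) :
    ∃ N : ℕ, ∀ n d r : ℕ, N ≤ n → n = b + (3 * d + r) → r ≤ 2 →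
      (a = 1 → r = 0 → ∀ (G : SimpleGraph (Fin n)) [DecidableRel G.Adj],
        G.IsExtremal (OrderFourForest.forest a b).Free ↔
          Nonempty (G ≃g OrderFourForest.graphOne b n)) ∧
      (a = 1 → r ≠ 0 → 1 ≤ b → ∀ (G : SimpleGraph (Fin n)) [DecidableRel G.Adj],
        G.IsExtremal (OrderFourForest.forest a b).Free ↔
          (Nonempty (G ≃g OrderFourForest.graphOne b n) ∨
            Nonempty (G ≃g OrderFourForest.graphTwo a b n))) ∧
      (1 < a → ∀ (G : SimpleGraph (Fin n)) [DecidableRel G.Adj],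
        G.IsExtremal (OrderFourForest.forest a b).Free ↔
          Nonempty (G ≃g OrderFourForest.graphTwo a b n)) := by
  obtain ⟨N₁, h₁⟩ := OrderFourForest.exists_isExtremal_iff_of_divisible b
  -- The truncated `b - 1` and, below, `a - 2` are used only when `1 ≤ b` and `1 < a`.
  obtain ⟨N₂, h₂⟩ := OrderFourForest.exists_isExtremal_iff_of_not_divisible (b - 1)
  obtain ⟨N₃, h₃⟩ := OrderFourForest.exists_isExtremal_iff_of_two_le (a - 2) b
  -- As `n ≤ b + 3 * d + 2`, the first summands give `N₁ + N₂ ≤ d`; the last bracket leaves at least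
  -- `N₃` independent vertices.
  refine ⟨b + 2 + 3 * (N₁ + N₂) + (2 * a + b + N₃), fun n d r hN hn hr => ⟨?_, ?_, ?_⟩⟩
  · rintro rfl rfl G _
    rw [OrderFourForest.nonempty_iso_graphOne_iff (r := 0) (d := d) (by omega) (by omega)]
    exact h₁ n d (by omega) (by omega) G
  · rintro rfl hr0 hb G _
    obtain ⟨b, rfl⟩ := Nat.exists_eq_add_of_le' hb
    rw [OrderFourForest.nonempty_iso_graphOne_iff (r := r) (d := d) (by omega) (by omega),
      OrderFourForest.nonempty_iso_graphTwo_iff (k := b + 1 + 1) (m := 3 * d + r - 1)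
        (by omega) (by omega)]
    exact h₂ n d r (by omega) hr0 hr hn G
  · intro ha G _
    obtain ⟨a, rfl⟩ := Nat.exists_eq_add_of_le' (show 2 ≤ a from ha)
    rw [OrderFourForest.nonempty_iso_graphTwo_iff (k := 2 * a + 3 + b)
      (m := n - (2 * a + 3 + b)) (by omega) rfl]
    exact h₃ n _ (by omega) (by omega) G
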